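/- **Conventions.** Let $G$ be a locally compact Hausdorff unimodular group with Haar measure $\mu$. For $K,A\subseteq G$ put $\partial_KA=K\overline{A}\cap K\overline{A^c}$. A net $(A_i)_{i\in I}$ of compact subsets of $G$ is a *Van Hove net* if $A_i$ has non-empty interior for all large $i$ and $\mu(\partial_KA_i)/\mu(A_i)\to0$ for every compact $K\subseteq G$. The group $G$ *satisfies the Ornstein–Weiss lemma* if for every function $f$ from the compact subsets of $G$ to $\mathbb R$ that is monotone, right invariant ($f(Ag)=f(A)$) and subadditive ($f(A\cup B)\le f(A)+f(B)$ for disjoint $A,B$), the limit $\lim_i f(A_i)/\mu(A_i)$ exists in $\mathbb R$ and is the same for all Van Hove nets. Let $X$ be a compact Hausdorff space; its entourages are the neighbourhoods of the diagonal in $X\times X$, and $\mathbb U_X$ is the set of all of them. For $\eta\in\mathbb U_X$ and $M\subseteq X$ let $\operatorname{cov}_M(\eta)$ be the minimal cardinality of a family of open sets $U\subseteq X$ with $U\times U\subseteq\eta$ that covers $M$; let $\operatorname{sep}_M(\eta)$ be the maximal cardinality of a set $S\subseteq M$ with $(t,s)\notin\eta$ for all distinct $s,t\in S$; and let $\operatorname{spa}_M(\eta)$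 be the minimal cardinality of a set $S\subseteq M$ such that for every $m\in M$ there is $s\in S$ with $(s,m)\in\eta$ or $(m,s)\in\eta$. For a map $p\colon X\to Y$ put $\operatorname{cov}_p(\eta)=\sup_{y\in Y}\operatorname{cov}_{p^{-1}(y)}(\eta)$, and define $\operatorname{sep}_p$, $\operatorname{spa}_p$ in the same way. If $G$ acts on $X$ and $A\subseteq G$, put $\eta_A=\{(x,y):(gx,gy)\in\eta\text{ for all }g\in A\}$. Let $\phi$ and $\psi$ be continuous actions of $G$ on $X$ and on a topological space $Y$, and let $p\colon X\to Y$ be a factor map (a continuous equivariant surjection). The relative topological entropy is $$\operatorname{E}(\phi\overset{p}{\to}\psi)=\sup_{\eta\in\mathbb U_X}\operatorname{E}(\eta|\phi\overset{p}{\to}\psi),\qquad \operatorname{E}(\eta|\phi\overset{p}{\to}\psi)=\lim_{i}\frac{\log\operatorname{cov}_p(\eta_{A_i})}{\mu(A_i)},$$ for a Van Hove net $(A_i)$ in $G$; formally, the limit is taken as the limit superior along the filter generated by all Van Hove conditions (the finest filter on the set of subsets of $G$ to which every Van Hove net tends), which agrees with the limit along every Van Hove net whenever that limit exists and is independent of the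 net. Values are extended reals, with $\log 0=-\infty$ (which occurs only for empty $X$). A uniform lattice, as a discrete group, carries the counting measure as Haar measure. A set $\Lambda\subseteq G$ is *relatively dense* if $K\Lambda=G$ for some compact $K\subseteq G$. A discrete set $\Lambda\subseteq G$ has a *well defined uniform density* if $\operatorname{dens}(\Lambda)=\lim_i|\Lambda\cap A_i|/\mu(A_i)$ exists, is finite, and is the same for all Van Hove nets. A *uniform lattice* is a discrete subgroup $\Lambda$ with $G/\Lambda$ compact. **Theorem.** Assume that $G$ satisfies the Ornstein–Weiss lemma. Let $\phi$ be a continuous action of $G$ on a compact Hausdorff space $X$, let $\psi$ be a factor of $\phi$ via the factor map $p\colon X\to Y$, and let $(A_i)_{i\in I}$ be a Van Hove net in $G$. Then for every $\eta\in\mathbb U_X$ the limit $\lim_i\log\operatorname{cov}_p(\eta_{A_i})/\mu(A_i)$ exists and equals $\operatorname{E}(\eta|\phi\overset{p}{\to}\psi)$, and the following hold. (i) Let $\Lambda\subseteq G$ be relatively dense with a well defined uniform density, and put $F_i=A_i\cap\Lambda$. Then $$\operatorname{E}(\phi\overset{p}{\to}\psi)=\operatorname{dens}(\Lambda)\sup_{\eta\in\mathbb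 U_X}\liminf_{i\in I}\frac{\log\operatorname{cov}_p(\eta_{F_i})}{|F_i|}=\operatorname{dens}(\Lambda)\sup_{\eta\in\mathbb U_X}\limsup_{i\in I}\frac{\log\operatorname{cov}_p(\eta_{F_i})}{|F_i|},$$ and both equalities remain valid with $\operatorname{cov}_p$ replaced by $\operatorname{sep}_p$ and by $\operatorname{spa}_p$. (ii) Let $\Lambda\subseteq G$ be a uniform lattice. Then $\Lambda$ has a well defined uniform density and $$\operatorname{E}(\phi\overset{p}{\to}\psi)=\operatorname{dens}(\Lambda)\,\operatorname{E}\bigl(\phi|_{\Lambda\times X}\overset{p}{\to}\psi|_{\Lambda\times Y}\bigr).$$ Moreover, for every Van Hove net $(D_j)_{j\in J}$ in $\Lambda$, $$\operatorname{E}\bigl(\phi|_{\Lambda\times X}\overset{p}{\to}\psi|_{\Lambda\times Y}\bigr)=\sup_{\eta\in\mathbb U_X}\liminf_{j\in J}\frac{\log\operatorname{cov}_p(\eta_{D_j})}{|D_j|}=\sup_{\eta\in\mathbb U_X}\limsup_{j\in J}\frac{\log\operatorname{cov}_p(\eta_{D_j})}{|D_j|}.$$ -/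

import Mathlib

open Set Filter Topology MeasureTheory
open scoped Pointwise ENNReal NNReal

universe u

/-! ### Van Hove nets, the Ornstein-Weiss lemma, uniform density -/

section Group

variable {G : Type u} [Group G] [TopologicalSpace G]

/-- The `K`-boundary of `A`. -/
def kBoundary (K A : Set G) : Set G := (K * closure A) ∩ (K * closure Aᶜ)

variable [MeasurableSpace G]

/-- A net of compact sets that eventually have non-empty interior is a Van Hove net (with respect to
the Haar measure `μ`) if `μ (∂_K A_i) / μ (A_i)` tends to `0` for every compact `K`. -/
structure IsVanHoveNet (μ : Measure G) {I : Type*} [PartialOrder I] (A : I → Set G) : Prop where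
  isCompact : ∀ i, IsCompact (A i)
  somewhereDense : ∀ᶠ i in atTop, (interior (A i)).Nonempty
  boundary : ∀ K : Set G, IsCompact K →
    Tendsto (fun i => μ (kBoundary K (A i)) / μ (A i)) atTop (𝓝 0)

/-- The coarsest filter on the subsets of `G` along which compact sets become somewhere dense and
satisfy the Van Hove condition. A net of compact sets is a Van Hove net if and only if it tends to
this filter (`isVanHoveNet_iff_tendsto`). -/
noncomputable def vanHoveFilter (μ : Measure G) : Filter (Set G) :=
  𝓟 {A | IsCompact A ∧ (interior A).Nonempty} ⊓
    ⨅ K ∈ {K : Set G | IsCompact K}, comap (fun A => μ (kBoundary K A) / μ A) (𝓝 0)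

theorem isVanHoveNet_iff_tendsto (μ : Measure G) {I : Type*} [PartialOrder I] (A : I → Set G)
    (hA : ∀ i, IsCompact (A i)) :
    IsVanHoveNet μ A ↔ Tendsto A atTop (vanHoveFilter μ) := by
  simp only [vanHoveFilter, tendsto_inf, tendsto_principal, tendsto_iInf, tendsto_comap_iff,
    mem_ofPred_eq]
  constructor
  · intro h
    exact ⟨h.somewhereDense.mono fun i hi => ⟨hA i, hi⟩, h.boundary⟩
  · rintro ⟨h₁, h₂⟩
    exact ⟨hA, h₁.mono fun i hi => hi.2, h₂⟩

/-- `f` is subadditive, right invariant and monotone as a function on the compact subsets of `G`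
(its values on other sets play no role). -/
structure IsOrnsteinWeissFunction (f : Set G → ℝ) : Prop where
  subadditive : ∀ A B : Set G, IsCompact A → IsCompact B → Disjoint A B → f (A ∪ B) ≤ f A + f B
  rightInvariant : ∀ (A : Set G) (g : G), IsCompact A → f (A * {g}) = f A
  monotone : ∀ A B : Set G, IsCompact A → IsCompact B → A ⊆ B → f A ≤ f B

/-- `G` satisfies the Ornstein-Weiss lemma: for every subadditive, right invariant and monotone
real function `f` on the compact sets, the limit of `f (A_i) / μ (A_i)` exists, is finite and does
not depend on the Van Hove net. -/
def SatisfiesOrnsteinWeiss (μ : Measure G) : Prop :=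
  ∀ f : Set G → ℝ, IsOrnsteinWeissFunction f →
    ∃ L : ℝ, ∀ (I : Type u) [PartialOrder I] [IsDirectedOrder I] [Nonempty I] (A : I → Set G),
      IsVanHoveNet μ A → Tendsto (fun i => f (A i) / (μ (A i)).toReal) atTop (𝓝 L)

/-- The discrete set `Λ` has a well defined uniform density, namely `d`: for every Van Hove net,
`|Λ ∩ A_i| / μ (A_i)` tends to the finite number `d`. -/
structure HasUniformDensity (μ : Measure G) (Λ : Set G) (d : ℝ≥0) : Prop where
  discrete : DiscreteTopology Λ
  tendsto : ∀ (I : Type u) [PartialOrder I] [IsDirectedOrder I] [Nonempty I] (A : I → Set G),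
    IsVanHoveNet μ A →
      Tendsto (fun i => (((A i ∩ Λ).encard : ℕ∞) : ℝ≥0∞) / μ (A i)) atTop (𝓝 (d : ℝ≥0∞))

/-- `K Λ = G` for some compact set `K`. -/
def IsRelativelyDense (Λ : Set G) : Prop := ∃ K : Set G, IsCompact K ∧ K * Λ = univ

/-- A discrete co-compact subgroup. -/
structure IsUniformLattice (Λ : Subgroup G) : Prop where
  discrete : DiscreteTopology Λ
  cocompact : CompactSpace (G ⧸ Λ)

end Group

/-! ### Covering, separation and spanning numbers

In a compact Hausdorff space `X` the entourages are the neighbourhoods of the diagonal, that is, the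
members of `𝓝ˢ (Set.diagonal X)`. -/

section Numbers

variable {X Y : Type*}

/-- Minimal cardinality of a family of open sets that covers `M` and consists of `η`-small sets. -/
noncomputable def covNumber [TopologicalSpace X] (η : Set (X × X)) (M : Set X) : ℕ∞ :=
  ⨅ (𝒰 : Set (Set X)) (_ : (∀ U ∈ 𝒰, IsOpen U ∧ U ×ˢ U ⊆ η) ∧ M ⊆ ⋃₀ 𝒰), 𝒰.encard

/-- Maximal cardinality of an `η`-separated subset of `M`. -/
noncomputable def sepNumber (η : Set (X × X)) (M : Set X) : ℕ∞ :=
  ⨆ (S : Set X) (_ : S ⊆ M ∧ ∀ s ∈ S, ∀ t ∈ S, t ≠ s → (t, s) ∉ η), S.encard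

/-- Minimal cardinality of a subset of `M` that is `η`-spanning for `M`. -/
noncomputable def spaNumber (η : Set (X × X)) (M : Set X) : ℕ∞ :=
  ⨅ (S : Set X) (_ : S ⊆ M ∧ ∀ m ∈ M, ∃ s ∈ S, (s, m) ∈ η ∨ (m, s) ∈ η), S.encard

/-- `cov_p(η)`: the supremum of the covering numbers of the fibres of `p`. -/
noncomputable def covFibre [TopologicalSpace X] (p : X → Y) (η : Set (X × X)) : ℕ∞ :=
  ⨆ y : Y, covNumber η (p ⁻¹' {y})

/-- `sep_p(η)`. -/
noncomputable def sepFibre (p : X → Y) (η : Set (X × X)) : ℕ∞ :=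
  ⨆ y : Y, sepNumber η (p ⁻¹' {y})

/-- `spa_p(η)`. -/
noncomputable def spaFibre (p : X → Y) (η : Set (X × X)) : ℕ∞ :=
  ⨆ y : Y, spaNumber η (p ⁻¹' {y})

/-- `log n / m` in the extended reals. -/
noncomputable def logRate (n : ℕ∞) (m : ℝ≥0∞) : EReal :=
  ENNReal.log (n : ℝ≥0∞) / (m : EReal)

end Numbers

/-! ### Actions and relative topological entropy -/

section Entropy

variable {G : Type u} [Group G] {X Y : Type*} [MulAction G X]

/-- The Bowen entourage `η_A`. -/
def bowenEntourage (η : Set (X × X)) (A : Set G) : Set (X × X) :=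
  {z | ∀ g ∈ A, (g • z.1, g • z.2) ∈ η}

/-- A factor map between two actions of `G`. -/
structure IsFactorMap (G : Type*) [Group G] {X Y : Type*} [TopologicalSpace X] [TopologicalSpace Y]
    [MulAction G X] [MulAction G Y] (p : X → Y) : Prop where
  continuous : Continuous p
  surjective : Function.Surjective p
  equivariant : ∀ (g : G) (x : X), p (g • x) = g • p x

variable [TopologicalSpace G] [MeasurableSpace G] [TopologicalSpace X]

/-- `E(η | φ → ψ)`: the limit of `log cov_p(η_A) / μ(A)` along Van Hove sets. In the groups
considered here the limit exists and does not depend on the Van Hove net; it is written as the limit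
superior along the filter of all Van Hove nets. -/
noncomputable def relEntropyAt (μ : Measure G) (p : X → Y) (η : Set (X × X)) : EReal :=
  limsup (fun A : Set G => logRate (covFibre p (bowenEntourage η A)) (μ A)) (vanHoveFilter μ)

/-- The relative topological entropy `E(φ → ψ)` of the action of `G` on `X` relative to its factor
on `Y`, with factor map `p`. -/
noncomputable def relEntropy (μ : Measure G) (p : X → Y) : EReal :=
  ⨆ η ∈ 𝓝ˢ (diagonal X), relEntropyAt μ p η

end Entropy

/-! ### Covering, separation and spanning numbers -/

section Numbers

variable {X Y : Type*}

/-! Intersecting covers makes the covering numbers submultiplicative, and the action permutes the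
fibres of `p`. Hence `A ↦ log cov_p(η_A)` is monotone, subadditive and right invariant, and the
Ornstein–Weiss lemma gives its limit along Van Hove nets. Encoding nets by `vanHoveFilter` turns
this into convergence along one filter.

The core is a discretisation principle, `relEntropy_eq_mul_iSup`. Let finite sets `F ⊆ B` satisfy
`|F| / μ(B) → d > 0` and `B ⊆ K F ∪ ∂_{K'} B`, with `B` running through Van Hove sets. Monotonicity
bounds `log cov_p(η_F)` by `log cov_p(η_B)`. Conversely, subadditivity bounds `log cov_p(η_B)` by
`log cov_p((η_K)_F)` plus the contribution of the boundary. A packing argument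
(`exists_logCov_le_measure`) makes that contribution `o(μ(B))`. Replacing `η` by `η_K` costs nothing
after the supremum over entourages. The same supremum absorbs the loss in comparing `cov`, `sep` and
`spa`, because the smaller entourage can be chosen independently of `F`.

For a relatively dense `Λ`, take `F = A ∩ Λ`; its density is positive by
`IsRelativelyDense.density_ne_zero`. For a uniform lattice, a precompact Borel fundamental domain `C
⊆ W` converts counting into Haar measure through `μ(C E) = μ(C) |E|`. Van Hove sets `D` of the
lattice thicken to Van Hove sets `W D` of `G`, so the principle applies with `F = D` and `d =
μ(C)⁻¹`. The Ornstein–Weiss lemma is needed for `G` only, not for the lattice. -/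

theorem covNumber_le_encard [TopologicalSpace X] {η : Set (X × X)} {M : Set X} {𝒰 : Set (Set X)}
    (h : ∀ U ∈ 𝒰, IsOpen U ∧ U ×ˢ U ⊆ η) (hM : M ⊆ ⋃₀ 𝒰) : covNumber η M ≤ 𝒰.encard :=
  iInf₂_le 𝒰 ⟨h, hM⟩

theorem covNumber_anti [TopologicalSpace X] {η θ : Set (X × X)} (h : θ ⊆ η) (M : Set X) :
    covNumber η M ≤ covNumber θ M :=
  le_iInf₂ fun _ h𝒰 =>
    covNumber_le_encard (fun U hU => ⟨(h𝒰.1 U hU).1, (h𝒰.1 U hU).2.trans h⟩) h𝒰.2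

theorem covNumber_mono [TopologicalSpace X] (η : Set (X × X)) {M M' : Set X} (h : M ⊆ M') :
    covNumber η M ≤ covNumber η M' :=
  le_iInf₂ fun _ h𝒰 => covNumber_le_encard h𝒰.1 (h.trans h𝒰.2)

theorem one_le_covNumber [TopologicalSpace X] (η : Set (X × X)) {M : Set X} (hM : M.Nonempty) :
    1 ≤ covNumber η M := by
  refine le_iInf₂ fun 𝒰 h𝒰 => ?_
  obtain ⟨x, hx⟩ := hM
  obtain ⟨U, hU, -⟩ := h𝒰.2 hx
  exact one_le_encard_iff_nonempty.2 ⟨U, hU⟩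

/-- If the covering number is finite, it is attained. -/
theorem exists_encard_eq_covNumber [TopologicalSpace X] {η : Set (X × X)} {M : Set X}
    (h : covNumber η M ≠ ⊤) :
    ∃ 𝒰 : Set (Set X), (∀ U ∈ 𝒰, IsOpen U ∧ U ×ˢ U ⊆ η) ∧ M ⊆ ⋃₀ 𝒰 ∧
      𝒰.encard = covNumber η M := by
  -- A finite infimum lies strictly below its successor, so some cover has cardinality below that
  -- successor.
  have hlt : covNumber η M < covNumber η M + 1 := by
    exact ENat.lt_add_one_iff h |>.2 le_rfl
  obtain ⟨𝒰, h𝒰⟩ := iInf_lt_iff.1 (show (⨅ (𝒰 : Set (Set X)) (_ : (∀ U ∈ 𝒰, IsOpen U ∧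
    U ×ˢ U ⊆ η) ∧ M ⊆ ⋃₀ 𝒰), 𝒰.encard) < covNumber η M + 1 from hlt)
  obtain ⟨h𝒰', h⟩ := iInf_lt_iff.1 h𝒰
  exact ⟨𝒰, h𝒰'.1, h𝒰'.2, le_antisymm (Order.le_of_lt_add_one h)
    (covNumber_le_encard h𝒰'.1 h𝒰'.2)⟩

theorem covNumber_inter_le [TopologicalSpace X] (η θ : Set (X × X)) (M : Set X)
    (hη : covNumber η M ≠ ⊤) (hθ : covNumber θ M ≠ ⊤) :
    covNumber (η ∩ θ) M ≤ covNumber η M * covNumber θ M := by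
  obtain ⟨𝒰, h𝒰, hM, h𝒰c⟩ := exists_encard_eq_covNumber hη
  obtain ⟨𝒱, h𝒱, hM', h𝒱c⟩ := exists_encard_eq_covNumber hθ
  rw [← h𝒰c, ← h𝒱c, ← encard_prod]
  refine (covNumber_le_encard (𝒰 := (fun q : Set X × Set X => q.1 ∩ q.2) '' (𝒰 ×ˢ 𝒱)) ?_ ?_).trans
    (encard_image_le _ _)
  · rintro _ ⟨⟨U, V⟩, ⟨hU, hV⟩, rfl⟩
    refine ⟨(h𝒰 U hU).1.inter (h𝒱 V hV).1, fun z hz => ⟨(h𝒰 U hU).2 ?_, (h𝒱 V hV).2 ?_⟩⟩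
    · exact ⟨hz.1.1, hz.2.1⟩
    · exact ⟨hz.1.2, hz.2.2⟩
  · intro x hx
    obtain ⟨U, hU, hxU⟩ := hM hx
    obtain ⟨V, hV, hxV⟩ := hM' hx
    exact ⟨U ∩ V, ⟨⟨U, V⟩, ⟨hU, hV⟩, rfl⟩, hxU, hxV⟩

theorem covNumber_univ_ne_top [TopologicalSpace X] [CompactSpace X] {η : Set (X × X)}
    (hη : η ∈ 𝓝ˢ (diagonal X)) : covNumber η (univ : Set X) ≠ ⊤ := by
  have key : ∀ x : X, ∃ U : Set X, IsOpen U ∧ x ∈ U ∧ U ×ˢ U ⊆ η := fun x => by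
    have h : η ∈ 𝓝 (x, x) := mem_nhdsSet_iff_forall.1 hη (x, x) rfl
    obtain ⟨U, V, hU, hxU, hV, hxV, hUV⟩ := mem_nhds_prod_iff'.1 h
    exact ⟨U ∩ V, hU.inter hV, ⟨hxU, hxV⟩, fun z hz => hUV ⟨hz.1.1, hz.2.2⟩⟩
  choose U hUo hxU hU using key
  obtain ⟨t, ht⟩ := isCompact_univ.elim_finite_subcover U hUo
    (fun x _ => mem_iUnion.2 ⟨x, hxU x⟩)
  refine ne_top_of_le_ne_top ?_ (covNumber_le_encard (𝒰 := U '' (t : Set X)) ?_ ?_)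
  · exact encard_ne_top_iff.2 (t.finite_toSet.image U)
  · rintro _ ⟨x, -, rfl⟩
    exact ⟨hUo x, hU x⟩
  · intro x hx
    obtain ⟨y, hy, hxy⟩ := mem_iUnion₂.1 (ht hx)
    exact ⟨U y, ⟨y, hy, rfl⟩, hxy⟩

theorem covFibre_ne_top [TopologicalSpace X] [CompactSpace X] (p : X → Y) {η : Set (X × X)}
    (hη : η ∈ 𝓝ˢ (diagonal X)) : covFibre p η ≠ ⊤ :=
  ne_top_of_le_ne_top (covNumber_univ_ne_top hη)
    (iSup_le fun _ => covNumber_mono η (subset_univ _))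

theorem covFibre_anti [TopologicalSpace X] (p : X → Y) {η θ : Set (X × X)} (h : θ ⊆ η) :
    covFibre p η ≤ covFibre p θ :=
  iSup_mono fun _ => covNumber_anti h _

theorem one_le_covFibre [TopologicalSpace X] [Nonempty X] (p : X → Y) (η : Set (X × X)) :
    1 ≤ covFibre p η := by
  obtain ⟨x⟩ := ‹Nonempty X›
  exact le_iSup_of_le (p x) (one_le_covNumber η ⟨x, rfl⟩)

theorem covFibre_of_isEmpty [TopologicalSpace X] [IsEmpty X] (p : X → Y) (η : Set (X × X)) :
    covFibre p η = 0 := by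
  refine le_antisymm (iSup_le fun y => ?_) zero_le
  refine (covNumber_le_encard (𝒰 := ∅) (by simp) fun x => isEmptyElim x).trans (by simp)

theorem covFibre_inter_le [TopologicalSpace X] [CompactSpace X] (p : X → Y) {η θ : Set (X × X)}
    (hη : η ∈ 𝓝ˢ (diagonal X)) (hθ : θ ∈ 𝓝ˢ (diagonal X)) :
    covFibre p (η ∩ θ) ≤ covFibre p η * covFibre p θ :=
  iSup_le fun y => (covNumber_inter_le η θ _
    (ne_top_of_le_ne_top (covFibre_ne_top p hη) (le_iSup (fun y => covNumber η (p ⁻¹' {y})) y))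
    (ne_top_of_le_ne_top (covFibre_ne_top p hθ)
      (le_iSup (fun y => covNumber θ (p ⁻¹' {y})) y))).trans
    (mul_le_mul' (le_iSup (fun y => covNumber η (p ⁻¹' {y})) y)
      (le_iSup (fun y => covNumber θ (p ⁻¹' {y})) y))

/-- An `η`-small set contains at most one point of an `η`-separated set, so choosing a cover element
for each point is injective. -/
theorem sepNumber_le_covNumber [TopologicalSpace X] (η : Set (X × X)) (M : Set X) :
    sepNumber η M ≤ covNumber η M := by
  refine iSup₂_le fun S hS => le_iInf₂ fun 𝒰 h𝒰 => ?_
  have h : ∀ s ∈ S, ∃ U ∈ 𝒰, s ∈ U := fun s hs => h𝒰.2 (hS.1 hs)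
  choose! U hU hsU using h
  refine encard_le_encard_of_injOn (f := U) hU fun s hs t ht hst => ?_
  by_contra hne
  exact hS.2 t ht s hs hne ((h𝒰.1 _ (hU s hs)).2 ⟨hsU s hs, hst ▸ hsU t ht⟩)

/-- A maximal separated set is spanning: a point that it fails to span could be added. Since `η`
need not be symmetric, this uses that spanning admits either order of the pair. -/
theorem spaNumber_le_sepNumber {η : Set (X × X)} (hη : diagonal X ⊆ η) (M : Set X) :
    spaNumber η M ≤ sepNumber η M := by
  obtain ⟨S, hS⟩ := zorn_subset {S : Set X | S ⊆ M ∧ ∀ s ∈ S, ∀ t ∈ S, t ≠ s → (t, s) ∉ η} (by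
    intro c hc hchain
    refine ⟨⋃₀ c, ⟨sUnion_subset fun S hS => (hc hS).1, ?_⟩, fun S hS => subset_sUnion_of_mem hS⟩
    rintro s ⟨S, hS, hs⟩ t ⟨T, hT, ht⟩ hne
    rcases hchain.total hS hT with h | h
    · exact (hc hT).2 s (h hs) t ht hne
    · exact (hc hS).2 s hs t (h ht) hne)
  refine (iInf₂_le S ⟨hS.prop.1, fun m hm => ?_⟩).trans (le_iSup₂_of_le S hS.prop le_rfl)
  by_contra! hcon
  have hmS : m ∉ S := fun h => (hcon m h).1 (hη rfl)
  refine hmS (hS.le_of_ge (y := insert m S) ⟨insert_subset hm hS.prop.1, ?_⟩ (subset_insert m S)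
    (mem_insert m S))
  rintro s (rfl | hs) t (rfl | ht) hne
  · exact absurd rfl hne
  · exact (hcon t ht).1
  · exact (hcon s hs).2
  · exact hS.prop.2 s hs t ht hne

/-- The slices of `θ` at the points of a spanning set cover `M`. They are open because `θ` is, and
`η`-small by symmetry and composition. -/
theorem covNumber_le_spaNumber [TopologicalSpace X] {η θ : Set (X × X)} (ho : IsOpen θ)
    (hsymm : ∀ x y, (x, y) ∈ θ → (y, x) ∈ θ) (hθ : ∀ x y z, (x, y) ∈ θ → (y, z) ∈ θ → (x, z) ∈ η)
    (M : Set X) : covNumber η M ≤ spaNumber θ M := by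
  refine le_iInf₂ fun S hS => ?_
  refine (covNumber_le_encard (𝒰 := (fun s => {x | (s, x) ∈ θ}) '' S) ?_ ?_).trans
    (encard_image_le _ _)
  · rintro _ ⟨s, -, rfl⟩
    exact ⟨ho.preimage (by fun_prop), fun z hz => hθ _ s _ (hsymm _ _ hz.1) hz.2⟩
  · intro m hm
    obtain ⟨s, hs, h | h⟩ := hS.2 m hm
    · exact ⟨_, ⟨s, hs, rfl⟩, h⟩
    · exact ⟨_, ⟨s, hs, rfl⟩, hsymm _ _ h⟩

/-- Entourages of a compact Hausdorff space contain the square of an open symmetric entourage. -/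
theorem exists_open_symm_entourage [TopologicalSpace X] [CompactSpace X] [T2Space X]
    {η : Set (X × X)} (hη : η ∈ 𝓝ˢ (diagonal X)) :
    ∃ θ ∈ 𝓝ˢ (diagonal X), IsOpen θ ∧ (∀ x y, (x, y) ∈ θ → (y, x) ∈ θ) ∧
      ∀ x y z, (x, y) ∈ θ → (y, z) ∈ θ → (x, z) ∈ η := by
  let _ : UniformSpace X := uniformSpaceOfCompactR1
  rw [nhdsSet_diagonal_eq_uniformity] at hη ⊢
  obtain ⟨θ, hθ, ho, hs, hc⟩ := comp_open_symm_mem_uniformity_sets hη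
  exact ⟨θ, hθ, ho, fun x y h => hs.symm _ _ h, fun x y z h h' => hc ⟨y, h, h'⟩⟩

theorem sepFibre_le_covFibre [TopologicalSpace X] (p : X → Y) (η : Set (X × X)) :
    sepFibre p η ≤ covFibre p η :=
  iSup_mono fun _ => sepNumber_le_covNumber η _

theorem spaFibre_le_sepFibre [TopologicalSpace X] (p : X → Y) {η : Set (X × X)}
    (hη : η ∈ 𝓝ˢ (diagonal X)) :
    spaFibre p η ≤ sepFibre p η :=
  iSup_mono fun _ => spaNumber_le_sepNumber (subset_of_mem_nhdsSet hη) _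

end Numbers

/-! ### Bowen entourages: unions, products and translations -/

section Bowen

variable {G : Type u} [Group G] {X Y : Type*} [MulAction G X]

theorem bowenEntourage_anti (η : Set (X × X)) {A B : Set G} (h : A ⊆ B) :
    bowenEntourage η B ⊆ bowenEntourage η A :=
  fun _ hz g hg => hz g (h hg)

theorem bowenEntourage_union (η : Set (X × X)) (A B : Set G) :
    bowenEntourage η (A ∪ B) = bowenEntourage η A ∩ bowenEntourage η B := by
  ext z
  exact ⟨fun h => ⟨fun g hg => h g (.inl hg), fun g hg => h g (.inr hg)⟩,
    fun h g hg => hg.elim (h.1 g) (h.2 g)⟩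

/-- This moves a thickening by `K` from the subset of the group to the entourage, where the supremum
over all entourages absorbs it. -/
theorem bowenEntourage_mul (η : Set (X × X)) (K A : Set G) :
    bowenEntourage η (K * A) = bowenEntourage (bowenEntourage η K) A := by
  ext z
  constructor
  · intro h g hg k hk
    simpa [mul_smul] using h (k * g) (mul_mem_mul hk hg)
  · rintro h _ ⟨k, hk, g, hg, rfl⟩
    simpa [mul_smul] using h g hg k hk

theorem bowenEntourage_image_subtype (η : Set (X × X)) (Λ : Subgroup G) (D : Set Λ) :
    bowenEntourage η ((↑) '' D : Set G) = bowenEntourage η D := by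
  ext z
  simp [bowenEntourage, Subgroup.smul_def]

/-- Tube lemma: the condition is open in point and group element jointly, and compactness of `A`
makes the neighbourhood uniform in `g ∈ A`. -/
theorem bowenEntourage_mem_nhdsSet [TopologicalSpace G] [TopologicalSpace X] [ContinuousSMul G X]
    {η : Set (X × X)} (hη : η ∈ 𝓝ˢ (diagonal X)) {A : Set G} (hA : IsCompact A) :
    bowenEntourage η A ∈ 𝓝ˢ (diagonal X) := by
  refine mem_nhdsSet_iff_forall.2 ?_
  rintro ⟨x, y⟩ (rfl : x = y)
  refine hA.eventually_forall_of_forall_eventually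
    (P := fun (z : X × X) (g : G) => (g • z.1, g • z.2) ∈ η)
    fun g _ => ?_
  have hc : Continuous fun q : (X × X) × G => (q.2 • q.1.1, q.2 • q.1.2) := by fun_prop
  exact hc.continuousAt (mem_nhdsSet_iff_forall.1 hη (g • x, g • x) rfl)

variable [TopologicalSpace G] [TopologicalSpace X] [ContinuousSMul G X]

theorem IsOpen.bowenEntourage {η : Set (X × X)} (hη : IsOpen η) {A : Set G} (hA : A.Finite) :
    IsOpen (bowenEntourage η A) := by
  have : _root_.bowenEntourage η A = ⋂ g ∈ A, (fun z : X × X => (g • z.1, g • z.2)) ⁻¹' η := by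
    ext z
    simp [_root_.bowenEntourage]
  rw [this]
  exact hA.isOpen_biInter fun g _ => hη.preimage (by fun_prop)

theorem covNumber_bowenEntourage_singleton (η : Set (X × X)) (g : G) (M : Set X) :
    covNumber (bowenEntourage η {g}) M ≤ covNumber η ((g • ·) '' M) := by
  refine le_iInf₂ fun 𝒰 h𝒰 => ?_
  refine (covNumber_le_encard (𝒰 := (fun U => (g • ·) ⁻¹' U) '' 𝒰) ?_ ?_).trans
    (encard_image_le _ _)
  · rintro _ ⟨U, hU, rfl⟩
    refine ⟨(h𝒰.1 U hU).1.preimage (by fun_prop), ?_⟩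
    rintro z hz g rfl
    exact (h𝒰.1 U hU).2 ⟨hz.1, hz.2⟩
  · intro x hx
    obtain ⟨U, hU, hxU⟩ := h𝒰.2 ⟨x, hx, rfl⟩
    exact ⟨_, ⟨U, hU, rfl⟩, hxU⟩

theorem covFibre_bowenEntourage_union_le [CompactSpace X] (p : X → Y) {η : Set (X × X)}
    (hη : η ∈ 𝓝ˢ (diagonal X))
    {A B : Set G} (hA : IsCompact A) (hB : IsCompact B) :
    covFibre p (bowenEntourage η (A ∪ B)) ≤
      covFibre p (bowenEntourage η A) * covFibre p (bowenEntourage η B) := by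
  rw [bowenEntourage_union]
  exact covFibre_inter_le p (bowenEntourage_mem_nhdsSet hη hA) (bowenEntourage_mem_nhdsSet hη hB)

variable (G) in
/-- Covering numbers are controlled by spanning numbers with respect to a smaller entourage,
uniformly over the finite Bowen entourages. -/
theorem exists_covFibre_le_spaFibre [CompactSpace X] [T2Space X] (p : X → Y) {η : Set (X × X)}
    (hη : η ∈ 𝓝ˢ (diagonal X)) : ∃ θ ∈ 𝓝ˢ (diagonal X), ∀ F : Set G, F.Finite →
      covFibre p (bowenEntourage η F) ≤ spaFibre p (bowenEntourage θ F) := by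
  obtain ⟨θ, hθ, ho, hs, hc⟩ := exists_open_symm_entourage hη
  -- Symmetry and composition pass to Bowen entourages pointwise in `g`, so one `θ` serves all `F`.
  -- Finiteness of `F` keeps `θ_F` open.
  exact ⟨θ, hθ, fun F hF => iSup_mono fun y => covNumber_le_spaNumber (ho.bowenEntourage hF)
    (η := bowenEntourage η F) (fun x y h g hg => hs _ _ (h g hg))
    (fun x y z h h' g hg => hc _ _ _ (h g hg) (h' g hg)) _⟩

variable [TopologicalSpace Y] [MulAction G Y] {p : X → Y}

/-- Translation by `g` carries the fibre over `y` into the fibre over `g • y`, and the supremum runs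
over all fibres. -/
theorem covFibre_bowenEntourage_singleton_le (hp : IsFactorMap G p) (η : Set (X × X)) (g : G) :
    covFibre p (bowenEntourage η {g}) ≤ covFibre p η := by
  refine iSup_le fun y => (covNumber_bowenEntourage_singleton η g _).trans
    ((covNumber_mono η ?_).trans (le_iSup (fun y => covNumber η (p ⁻¹' {y})) (g • y)))
  rintro _ ⟨x, hx, rfl⟩
  simp only [mem_preimage, mem_singleton_iff] at hx ⊢
  rw [hp.equivariant, hx]

theorem covFibre_bowenEntourage_mul_singleton (hp : IsFactorMap G p) (η : Set (X × X))
    (A : Set G) (g : G) :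
    covFibre p (bowenEntourage η (A * {g})) = covFibre p (bowenEntourage η A) := by
  have key : ∀ (A : Set G) (g : G),
      covFibre p (bowenEntourage η (A * {g})) ≤ covFibre p (bowenEntourage η A) := fun A g => by
    rw [bowenEntourage_mul]
    exact covFibre_bowenEntourage_singleton_le hp _ g
  refine le_antisymm (key A g) ?_
  have := key (A * {g}) g⁻¹
  rwa [mul_assoc, singleton_mul_singleton, mul_inv_cancel, singleton_one, mul_one] at this

end Bowen

/-! ### Boundaries and Van Hove filters -/

/-- Every filter is the tail filter of a net indexed by a directed partial order of the same
universe. -/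
theorem Filter.exists_net {α : Type u} (l : Filter α) [l.NeBot] {s : Set α} (hs : s ∈ l) :
    ∃ (I : Type u) (_ : PartialOrder I) (_ : IsDirectedOrder I) (_ : Nonempty I) (a : I → α),
      (∀ i, a i ∈ s) ∧ map a atTop = l := by
  -- An index is a member of `l` with a chosen point in it. The natural number grows strictly at
  -- every proper step, which makes the order antisymmetric although sets and points may repeat.
  let I := {q : Set α × α × ℕ // q.1 ∈ l ∧ q.1 ⊆ s ∧ q.2.1 ∈ q.1}
  let ord : PartialOrder I :=
    { le := fun q r => q = r ∨ (r.1.1 ⊆ q.1.1 ∧ q.1.2.2 < r.1.2.2)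
      le_refl := fun q => .inl rfl
      le_trans := by
        rintro q r t (rfl | h) (rfl | h')
        · exact .inl rfl
        · exact .inr h'
        · exact .inr h
        · exact .inr ⟨h'.1.trans h.1, h.2.trans h'.2⟩
      le_antisymm := by
        rintro q r (rfl | h) (h' | h')
        · rfl
        · rfl
        · exact h'.symm
        · exact absurd (h.2.trans h'.2) (lt_irrefl _) }
  have hdir : IsDirectedOrder I := ⟨fun q r => by
    obtain ⟨x, hx⟩ := nonempty_of_mem (inter_mem q.2.1 r.2.1)
    exact ⟨⟨(q.1.1 ∩ r.1.1, x, max q.1.2.2 r.1.2.2 + 1), inter_mem q.2.1 r.2.1,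
      inter_subset_left.trans q.2.2.1, hx⟩,
      .inr ⟨inter_subset_left, Nat.lt_succ_of_le (le_max_left _ _)⟩,
      .inr ⟨inter_subset_right, Nat.lt_succ_of_le (le_max_right _ _)⟩⟩⟩
  obtain ⟨x₀, hx₀⟩ := nonempty_of_mem hs
  have hne : Nonempty I := ⟨⟨(s, x₀, 0), hs, subset_rfl, hx₀⟩⟩
  refine ⟨I, ord, hdir, hne, fun q => q.1.2.1, fun q => q.2.2.1 q.2.2.2, le_antisymm ?_ ?_⟩
  · intro S hS
    obtain ⟨x, hx⟩ := nonempty_of_mem (inter_mem hS hs)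
    refine mem_map.2 (mem_atTop_sets.2
      ⟨⟨(S ∩ s, x, 0), inter_mem hS hs, inter_subset_right, hx⟩, ?_⟩)
    rintro r (h | h)
    · rw [← h]
      exact hx.1
    · exact (h.1 r.2.2.2).1
  · intro S hS
    obtain ⟨q, hq⟩ := mem_atTop_sets.1 (mem_map.1 hS)
    refine mem_of_superset q.2.1 fun y hy => ?_
    exact hq ⟨(q.1.1, y, q.1.2.2 + 1), q.2.1, q.2.2.1, hy⟩ (.inr ⟨subset_rfl, Nat.lt_succ_self _⟩)

section Boundary

variable {G : Type u} [Group G] [TopologicalSpace G]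

theorem mul_kBoundary_subset (V K A : Set G) : V * kBoundary K A ⊆ kBoundary (V * K) A := by
  simp only [kBoundary, mul_assoc]
  exact mul_inter_subset

theorem mul_subset_union_kBoundary {K : Set G} (hK : 1 ∈ K) (A : Set G) :
    K * A ⊆ A ∪ kBoundary K A := by
  intro x hx
  by_cases hxA : x ∈ A
  · exact .inl hxA
  · exact .inr ⟨mul_subset_mul_left subset_closure hx,
      ⟨1, hK, x, subset_closure hxA, one_mul x⟩⟩

/-- Write `a = k * l` with `l ∈ Λ`. If `l ∉ A`, then `a` lies in `K Aᶜ` and, thanks to the inserted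
`1`, also in the thickening of `A`. -/
theorem subset_mul_inter_union_kBoundary {K Λ : Set G} (hK : K * Λ = univ) (A : Set G) :
    A ⊆ K * (A ∩ Λ) ∪ kBoundary (insert 1 K) A := by
  intro a ha
  obtain ⟨k, hk, l, hl, rfl⟩ : a ∈ K * Λ := hK ▸ mem_univ a
  by_cases hlA : l ∈ A
  · exact .inl ⟨k, hk, l, ⟨hlA, hl⟩, rfl⟩
  · exact .inr ⟨⟨1, mem_insert _ _, _, subset_closure ha, one_mul _⟩,
      ⟨k, mem_insert_of_mem _ hk, l, subset_closure hlA, rfl⟩⟩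

section VanHove

variable [MeasurableSpace G] (μ : Measure G)

theorem eventually_isCompact_vanHoveFilter :
    ∀ᶠ A in vanHoveFilter μ, IsCompact A ∧ (interior A).Nonempty :=
  mem_inf_of_left (mem_principal_self _)

theorem tendsto_kBoundary_vanHoveFilter {K : Set G} (hK : IsCompact K) :
    Tendsto (fun A => μ (kBoundary K A) / μ A) (vanHoveFilter μ) (𝓝 0) :=
  (tendsto_comap (f := fun A => μ (kBoundary K A) / μ A)).mono_left
    (inf_le_right.trans (iInf₂_le K hK))

theorem tendsto_vanHoveFilter_iff {ι : Type*} {l : Filter ι} {B : ι → Set G} :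
    Tendsto B l (vanHoveFilter μ) ↔ (∀ᶠ i in l, IsCompact (B i) ∧ (interior (B i)).Nonempty) ∧
      ∀ K : Set G, IsCompact K → Tendsto (fun i => μ (kBoundary K (B i)) / μ (B i)) l (𝓝 0) := by
  simp only [vanHoveFilter, tendsto_inf, tendsto_principal, tendsto_iInf, tendsto_comap_iff,
    mem_ofPred_eq]
  rfl

/-- Statements about limits along Van Hove nets are statements about the Van Hove filter. -/
theorem tendsto_vanHoveFilter_of_nets {β : Type*} {f : Set G → β} {l : Filter β}
    (h : ∀ (I : Type u) [PartialOrder I] [IsDirectedOrder I] [Nonempty I] (A : I → Set G),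
      IsVanHoveNet μ A → Tendsto (fun i => f (A i)) atTop l) :
    Tendsto f (vanHoveFilter μ) l := by
  rcases (vanHoveFilter μ).eq_or_neBot with hbot | hne
  · rw [hbot]
    exact tendsto_bot
  obtain ⟨I, _, _, _, a, ha, hmap⟩ := (vanHoveFilter μ).exists_net
    (eventually_isCompact_vanHoveFilter μ)
  have := h I a ((isVanHoveNet_iff_tendsto μ a fun i => (ha i).1).2 hmap.le)
  rwa [← hmap, tendsto_map'_iff]

theorem eventually_measure_vanHoveFilter [μ.IsOpenPosMeasure]
    [IsFiniteMeasureOnCompacts μ] : ∀ᶠ A in vanHoveFilter μ, μ A ≠ 0 ∧ μ A ≠ ⊤ :=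
  (eventually_isCompact_vanHoveFilter μ).mono fun _ hA =>
    ⟨(Measure.measure_pos_of_nonempty_interior μ hA.2).ne', hA.1.measure_lt_top.ne⟩

end VanHove

variable [IsTopologicalGroup G] [T2Space G]

theorem IsCompact.kBoundary {K A : Set G} (hK : IsCompact K) (hA : IsCompact A) :
    IsCompact (kBoundary K A) :=
  (hK.mul (hA.isClosed.closure_eq.symm ▸ hA)).inter_right
    (isClosed_closure.mul_left_of_isCompact hK)

/-- `K A` is already closed, and its complement lies in that of `A` because `1 ∈ K`; so its
`L`-boundary is controlled by a larger boundary of `A`. -/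
theorem kBoundary_mul_subset {K A : Set G} (L : Set G) (hK : IsCompact K) (hK1 : 1 ∈ K)
    (hA : IsCompact A) : kBoundary L (K * A) ⊆ kBoundary (L * K) A := by
  refine inter_subset_inter ?_ ?_
  · rw [(hK.mul hA).isClosed.closure_eq, mul_assoc]
    exact mul_subset_mul_left (mul_subset_mul_left subset_closure)
  · refine mul_subset_mul (fun x hx => ⟨x, hx, 1, hK1, mul_one x⟩) (closure_mono ?_)
    exact compl_subset_compl.2 fun x hx => ⟨1, hK1, x, hx, one_mul x⟩

/-- Thickening by a compact set does not change the measure asymptotically and preserves the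
Van Hove property. -/
theorem tendsto_mul_vanHoveFilter [MeasurableSpace G] (μ : Measure G) {K : Set G}
    (hK : IsCompact K) (hK1 : 1 ∈ K) :
    Tendsto (fun A => K * A) (vanHoveFilter μ) (vanHoveFilter μ) := by
  have hsub : ∀ A : Set G, A ⊆ K * A := fun A x hx => ⟨1, hK1, x, hx, one_mul x⟩
  refine (tendsto_vanHoveFilter_iff μ).2 ⟨?_, fun L hL => ?_⟩
  · exact (eventually_isCompact_vanHoveFilter μ).mono fun A hA =>
      ⟨hK.mul hA.1, hA.2.mono (interior_mono (hsub A))⟩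
  · refine tendsto_of_tendsto_of_tendsto_of_le_of_le' tendsto_const_nhds
      (tendsto_kBoundary_vanHoveFilter μ (hL.mul hK)) (.of_forall fun _ => zero_le) ?_
    filter_upwards [eventually_isCompact_vanHoveFilter μ] with A hA
    exact ENNReal.div_le_div (measure_mono (kBoundary_mul_subset L hK hK1 hA.1))
      (measure_mono (hsub A))

end Boundary

/-! ### Logarithmic covering numbers -/

theorem logRate_eq_coe {n : ℕ∞} {m : ℝ≥0∞} (hn : n ≠ 0) (hn' : n ≠ ⊤) (hm : m ≠ ⊤) :
    logRate n m = ((Real.log n.toNat / m.toReal : ℝ) : EReal) := by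
  lift n to ℕ using hn'
  rw [logRate, EReal.coe_div, EReal.coe_ennreal_toReal hm, ENNReal.log_pos_real (by simpa using hn)
    (by simp)]
  simp

theorem logRate_mono {n n' : ℕ∞} (h : n ≤ n') (m : ℝ≥0∞) : logRate n m ≤ logRate n' m :=
  EReal.div_le_div_right_of_nonneg (EReal.coe_ennreal_nonneg m)
    (ENNReal.log_monotone (ENat.toENNReal_mono h))

theorem logRate_zero {m : ℝ≥0∞} (hm : m ≠ 0) (hm' : m ≠ ⊤) : logRate 0 m = ⊥ := by
  rw [logRate, ENat.toENNReal_zero, ENNReal.log_zero]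
  exact EReal.bot_div_of_pos_ne_top (by simpa using hm.bot_lt) (by simpa using hm')

section LogCov

variable {G : Type u} [Group G] {X Y : Type*} [MulAction G X] [TopologicalSpace X]

/-- The real number `log cov_p(η_A)`. -/
noncomputable def logCov (p : X → Y) (η : Set (X × X)) (A : Set G) : ℝ :=
  Real.log (covFibre p (bowenEntourage η A)).toNat

theorem logCov_empty (p : X → Y) (η : Set (X × X)) : logCov p η (∅ : Set G) = 0 := by
  have h : covFibre p (bowenEntourage η (∅ : Set G)) ≤ 1 := iSup_le fun y => by
    refine (covNumber_le_encard (𝒰 := {univ}) ?_ (by simp)).trans (encard_singleton _).le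
    rintro _ rfl
    exact ⟨isOpen_univ, fun _ _ g hg => hg.elim⟩
  -- The value is `1`, or `0` if `X` is empty; `Real.log` vanishes at both.
  have h' : (covFibre p (bowenEntourage η (∅ : Set G))).toNat ≤ 1 :=
    ENat.toNat_le_toNat h ENat.one_ne_top
  refine le_antisymm (Real.log_nonpos (by positivity) (by exact_mod_cast h')) ?_
  exact Real.log_natCast_nonneg _

theorem logCov_nonneg (p : X → Y) (η : Set (X × X)) (A : Set G) : 0 ≤ logCov p η A :=
  Real.log_natCast_nonneg _

variable [TopologicalSpace G] [CompactSpace X] [ContinuousSMul G X] [Nonempty X] (p : X → Y)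
  {η : Set (X × X)}

theorem one_le_toNat_covFibre (hη : η ∈ 𝓝ˢ (diagonal X)) {A : Set G} (hA : IsCompact A) :
    1 ≤ (covFibre p (bowenEntourage η A)).toNat := by
  have h := one_le_covFibre p (bowenEntourage η A)
  rw [← ENat.natCast_toNat (covFibre_ne_top p (bowenEntourage_mem_nhdsSet hη hA))] at h
  exact_mod_cast h

theorem logCov_mono (hη : η ∈ 𝓝ˢ (diagonal X)) {A B : Set G} (hA : IsCompact A)
    (hB : IsCompact B) (h : A ⊆ B) : logCov p η A ≤ logCov p η B := by
  refine Real.log_le_log (by exact_mod_cast one_le_toNat_covFibre p hη hA) ?_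
  exact_mod_cast ENat.toNat_le_toNat (covFibre_anti p (bowenEntourage_anti η h))
    (covFibre_ne_top p (bowenEntourage_mem_nhdsSet hη hB))

theorem logCov_union_le (hη : η ∈ 𝓝ˢ (diagonal X)) {A B : Set G} (hA : IsCompact A)
    (hB : IsCompact B) : logCov p η (A ∪ B) ≤ logCov p η A + logCov p η B := by
  have hA0 := one_le_toNat_covFibre p hη hA
  have hB0 := one_le_toNat_covFibre p hη hB
  unfold logCov
  rw [← Real.log_mul (by positivity) (by positivity)]
  refine Real.log_le_log (by exact_mod_cast one_le_toNat_covFibre p hη (hA.union hB)) ?_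
  have := ENat.toNat_le_toNat (covFibre_bowenEntourage_union_le p hη hA hB)
    (WithTop.mul_ne_top (covFibre_ne_top p (bowenEntourage_mem_nhdsSet hη hA))
      (covFibre_ne_top p (bowenEntourage_mem_nhdsSet hη hB)))
  rw [ENat.toNat_mul] at this
  exact_mod_cast this

theorem logRate_covFibre_eq (hη : η ∈ 𝓝ˢ (diagonal X)) {A : Set G} (hA : IsCompact A) {m : ℝ≥0∞}
    (hm : m ≠ ⊤) : logRate (covFibre p (bowenEntourage η A)) m =
      ((logCov p η A / m.toReal : ℝ) : EReal) :=
  logRate_eq_coe (Order.one_le_iff_pos.1 (one_le_covFibre p _)).ne'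
    (covFibre_ne_top p (bowenEntourage_mem_nhdsSet hη hA)) hm

variable [TopologicalSpace Y] [MulAction G Y] {p}

theorem isOrnsteinWeissFunction_logCov (hp : IsFactorMap G p) (hη : η ∈ 𝓝ˢ (diagonal X)) :
    IsOrnsteinWeissFunction (fun A : Set G => logCov p η A) where
  subadditive _ _ hA hB _ := logCov_union_le p hη hA hB
  rightInvariant A g _ := by
    simp only [logCov, covFibre_bowenEntourage_mul_singleton hp]
  monotone _ _ hA hB h := logCov_mono p hη hA hB h

variable [IsTopologicalGroup G]

theorem logCov_mul_finset_le (hp : IsFactorMap G p) (hη : η ∈ 𝓝ˢ (diagonal X)) {Q : Set G}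
    (hQ : IsCompact Q) (S : Finset G) : logCov p η (Q * (S : Set G)) ≤ S.card * logCov p η Q := by
  classical
  induction S using Finset.induction_on with
  | empty =>
    simp [logCov_empty]
  | insert g S hg ih =>
    rw [Finset.coe_insert, insert_eq, mul_union, Finset.card_insert_of_notMem hg]
    have h1 := logCov_union_le p hη (hQ.mul (isCompact_singleton (x := g)))
      (hQ.mul S.finite_toSet.isCompact)
    rw [(isOrnsteinWeissFunction_logCov hp hη).rightInvariant Q g hQ] at h1
    push_cast
    linarith

/-- The logarithmic covering number of `Z` is at most proportional to the measure of a
neighbourhood of `Z`. -/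
theorem exists_logCov_le_measure [T2Space G] [LocallyCompactSpace G] [MeasurableSpace G]
    [BorelSpace G] (μ : Measure G) [μ.IsHaarMeasure] [μ.IsMulRightInvariant]
    (hp : IsFactorMap G p) (hη : η ∈ 𝓝ˢ (diagonal X)) :
    ∃ (V : Set G) (c : ℝ), IsCompact V ∧ 0 ≤ c ∧ ∀ Z : Set G, IsCompact Z →
      logCov p η Z ≤ c * (μ (V * Z)).toReal := by
  obtain ⟨V, hV, hV1⟩ := exists_compact_mem_nhds (1 : G)
  have hQ : IsCompact (V⁻¹ * V) := hV.inv.mul hV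
  have hV0 : 0 < (μ V).toReal :=
    ENNReal.toReal_pos (μ.measure_pos_of_mem_nhds hV1).ne' hV.measure_lt_top.ne
  refine ⟨V, logCov p η (V⁻¹ * V) / (μ V).toReal, hV,
    div_nonneg (logCov_nonneg _ _ _) hV0.le, fun Z hZ => ?_⟩
  have hVZ : μ (V * Z) ≠ ⊤ := (hV.mul hZ).measure_lt_top.ne
  -- Packings of `V Z` by disjoint translates `V g` with `g ∈ Z`. Right invariance bounds their
  -- cardinality by `μ(V Z) / μ(V)`, so a largest one exists.
  let P : Finset G → Prop := fun S =>
    (S : Set G) ⊆ Z ∧ (S : Set G).PairwiseDisjoint fun g => V * {g}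
  have hcard : ∀ S, P S → S.card * (μ V).toReal ≤ (μ (V * Z)).toReal := by
    intro S hS
    have h : (S.card : ℝ≥0∞) * μ V ≤ μ (V * Z) := by
      have h1 : μ (⋃ g ∈ S, V * {g}) = ∑ g ∈ S, μ (V * {g}) :=
        measure_biUnion_finset hS.2 fun g _ => (hV.mul isCompact_singleton).measurableSet
      have h2 : ∀ g, μ (V * {g}) = μ V := fun g => by
        rw [mul_singleton, image_mul_right, measure_preimage_mul_right]
      simp only [h2, Finset.sum_const, nsmul_eq_mul] at h1
      rw [← h1]
      exact measure_mono (iUnion₂_subset fun g hg =>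
        mul_subset_mul_left (singleton_subset_iff.2 (hS.1 hg)))
    have := ENNReal.toReal_mono hVZ h
    rwa [ENNReal.toReal_mul, ENNReal.toReal_natCast] at this
  obtain ⟨N, hN⟩ := exists_nat_ge ((μ (V * Z)).toReal / (μ V).toReal)
  have hbdd : BddAbove {n : ℕ | ∃ S, P S ∧ S.card = n} := by
    refine ⟨N, ?_⟩
    rintro _ ⟨S, hS, rfl⟩
    exact_mod_cast ((le_div_iff₀ hV0).2 (hcard S hS)).trans hN
  obtain ⟨S, hS, hSn⟩ := Nat.sSup_mem (s := {n : ℕ | ∃ S, P S ∧ S.card = n})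
    ⟨0, ∅, ⟨by simp, by simp⟩, rfl⟩ hbdd
  -- By maximality `V z` meets some `V s` with `s ∈ S`, that is, `z ∈ V⁻¹ V s`.
  have hcover : Z ⊆ V⁻¹ * V * (S : Set G) := by
    classical
    intro z hz
    by_contra hzS
    have hdisj : ∀ s ∈ S, Disjoint (V * {z}) (V * {s}) := by
      intro s hs
      rw [Set.disjoint_left]
      rintro _ ⟨v, hv, _, rfl, rfl⟩ ⟨w, hw, _, rfl, h⟩
      refine hzS ⟨v⁻¹ * w, mul_mem_mul (inv_mem_inv.2 hv) hw, _, hs, ?_⟩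
      simp only at h ⊢
      rw [mul_assoc, h, inv_mul_cancel_left]
    have hzmem : z ∉ S := fun h => by
      have := hdisj z h
      rw [disjoint_self] at this
      exact absurd this
        (Nonempty.ne_empty ⟨1 * z, 1, mem_of_mem_nhds hV1, z, rfl, rfl⟩)
    have hP : P (insert z S) := by
      refine ⟨by rw [Finset.coe_insert]; exact insert_subset hz hS.1, ?_⟩
      rw [Finset.coe_insert]
      exact hS.2.insert fun s hs _ => hdisj s hs
    have hle := le_csSup hbdd ⟨_, hP, rfl⟩
    rw [← hSn, Finset.card_insert_of_notMem hzmem] at hle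
    omega
  calc logCov p η Z ≤ logCov p η (V⁻¹ * V * (S : Set G)) :=
        logCov_mono p hη hZ (hQ.mul S.finite_toSet.isCompact) hcover
    _ ≤ S.card * logCov p η (V⁻¹ * V) := logCov_mul_finset_le hp hη hQ S
    _ ≤ (μ (V * Z)).toReal / (μ V).toReal * logCov p η (V⁻¹ * V) :=
        mul_le_mul_of_nonneg_right ((le_div_iff₀ hV0).2 (hcard S hS)) (logCov_nonneg _ _ _)
    _ = _ := by ring

end LogCov

/-! ### Relative entropy along discrete approximations of Van Hove sets -/

section Limit

variable {G : Type u} [Group G] [TopologicalSpace G] [MeasurableSpace G]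
  {X Y : Type*} [TopologicalSpace X] [CompactSpace X] [MulAction G X] [ContinuousSMul G X]
  [TopologicalSpace Y] [MulAction G Y] {p : X → Y} {η : Set (X × X)}

theorem exists_tendsto_logCov {μ : Measure G} [Nonempty X] (hOW : SatisfiesOrnsteinWeiss μ)
    (hp : IsFactorMap G p) (hη : η ∈ 𝓝ˢ (diagonal X)) :
    ∃ L : ℝ, Tendsto (fun A : Set G => logCov p η A / (μ A).toReal) (vanHoveFilter μ) (𝓝 L) := by
  obtain ⟨L, hL⟩ := hOW _ (isOrnsteinWeissFunction_logCov hp hη)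
  exact ⟨L, tendsto_vanHoveFilter_of_nets μ hL⟩

variable {μ : Measure G} [IsFiniteMeasureOnCompacts μ]

theorem exists_relEntropyAt_eq_coe [(vanHoveFilter μ).NeBot] [Nonempty X]
    (hOW : SatisfiesOrnsteinWeiss μ) (hp : IsFactorMap G p) (hη : η ∈ 𝓝ˢ (diagonal X)) :
    ∃ L : ℝ, relEntropyAt μ p η = L ∧
      Tendsto (fun A : Set G => logCov p η A / (μ A).toReal) (vanHoveFilter μ) (𝓝 L) ∧
      Tendsto (fun A : Set G => logRate (covFibre p (bowenEntourage η A)) (μ A))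
        (vanHoveFilter μ) (𝓝 (L : EReal)) := by
  obtain ⟨L, hL⟩ := exists_tendsto_logCov hOW hp hη
  have hrate : Tendsto (fun A : Set G => logRate (covFibre p (bowenEntourage η A)) (μ A))
      (vanHoveFilter μ) (𝓝 (L : EReal)) := by
    refine (EReal.tendsto_coe.2 hL).congr' ?_
    filter_upwards [eventually_isCompact_vanHoveFilter μ] with A hA
    exact (logRate_covFibre_eq p hη hA.1 hA.1.measure_lt_top.ne).symm
  exact ⟨L, hrate.limsup_eq, hL, hrate⟩

omit [CompactSpace X] [ContinuousSMul G X] [TopologicalSpace Y] [MulAction G Y] in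
theorem tendsto_logRate_of_isEmpty [μ.IsOpenPosMeasure] [IsEmpty X] (p : X → Y) (η : Set (X × X)) :
    Tendsto (fun A : Set G => logRate (covFibre p (bowenEntourage η A)) (μ A))
      (vanHoveFilter μ) (𝓝 ⊥) := by
  refine tendsto_const_nhds.congr' ?_
  filter_upwards [eventually_measure_vanHoveFilter μ] with A hA
  rw [covFibre_of_isEmpty, logRate_zero hA.1 hA.2]

theorem tendsto_relEntropyAt [μ.IsOpenPosMeasure] [(vanHoveFilter μ).NeBot]
    (hOW : SatisfiesOrnsteinWeiss μ) (hp : IsFactorMap G p) (hη : η ∈ 𝓝ˢ (diagonal X)) :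
    Tendsto (fun A : Set G => logRate (covFibre p (bowenEntourage η A)) (μ A))
      (vanHoveFilter μ) (𝓝 (relEntropyAt μ p η)) := by
  -- For empty `X` the rate is `⊥`, whereas the real-valued `logCov` would give `0`; hence the
  -- separate case.
  rcases isEmpty_or_nonempty X with hX | hX
  · have h := tendsto_logRate_of_isEmpty (μ := μ) p η
    rwa [relEntropyAt, h.limsup_eq]
  · obtain ⟨L, hL, -, h⟩ := exists_relEntropyAt_eq_coe hOW hp hη
    rwa [hL]

end Limit

/-- The lower bound may pass to a smaller entourage `θ`, which is harmless under the supremum;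
`liminf ≤ limsup` then closes a circle of inequalities. -/
theorem eq_mul_iSup_liminf_and_limsup {α ι : Type*} {l : Filter ι} [l.NeBot] {𝓕 : Filter α}
    {d : ℝ≥0} (hd : d ≠ 0) {e : Set α → EReal} {u : Set α → ι → EReal}
    (upper : ∀ η ∈ 𝓕, limsup (u η) l ≤ e η / ((d : ℝ) : EReal))
    (lower : ∀ η ∈ 𝓕, ∃ θ ∈ 𝓕, e η / ((d : ℝ) : EReal) ≤ liminf (u θ) l) :
    (⨆ η ∈ 𝓕, e η) = ((d : ℝ) : EReal) * ⨆ η ∈ 𝓕, liminf (u η) l ∧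
    (⨆ η ∈ 𝓕, e η) = ((d : ℝ) : EReal) * ⨆ η ∈ 𝓕, limsup (u η) l := by
  have hd0 : (0 : EReal) < ((d : ℝ) : EReal) := by exact_mod_cast hd.bot_lt
  have hdt : ((d : ℝ) : EReal) ≠ ⊤ := EReal.coe_ne_top _
  have h1 : (⨆ η ∈ 𝓕, e η) ≤ ((d : ℝ) : EReal) * ⨆ η ∈ 𝓕, liminf (u η) l := by
    refine iSup₂_le fun η hη => ?_
    obtain ⟨θ, hθ, h⟩ := lower η hη
    exact (EReal.div_le_iff_le_mul hd0 hdt).1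
      (h.trans (le_iSup₂ (f := fun η _ => liminf (u η) l) θ hθ))
  have h2 : ((d : ℝ) : EReal) * (⨆ η ∈ 𝓕, liminf (u η) l) ≤
      ((d : ℝ) : EReal) * ⨆ η ∈ 𝓕, limsup (u η) l :=
    mul_le_mul_of_nonneg_left (iSup₂_mono fun η _ => liminf_le_limsup) hd0.le
  have h3 : ((d : ℝ) : EReal) * (⨆ η ∈ 𝓕, limsup (u η) l) ≤ ⨆ η ∈ 𝓕, e η := by
    rw [mul_comm, ← EReal.le_div_iff_mul_le hd0 hdt]
    exact iSup₂_le fun η hη => (upper η hη).trans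
      (EReal.div_le_div_right_of_nonneg hd0.le (le_iSup₂ (f := fun η _ => e η) η hη))
  exact ⟨le_antisymm h1 (h2.trans h3), le_antisymm (h1.trans h2) h3⟩

section Discretisation

variable {G : Type u} [Group G] [TopologicalSpace G] [MeasurableSpace G]
  {μ : Measure G} [IsFiniteMeasureOnCompacts μ] [μ.IsOpenPosMeasure]
  {X : Type*} [TopologicalSpace X] [CompactSpace X] [MulAction G X] [ContinuousSMul G X]
  {Y : Type*} [TopologicalSpace Y] [MulAction G Y] {p : X → Y}
  {ι : Type*} {l : Filter ι} {B F : ι → Set G} {d : ℝ≥0}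

/-- A limit ratio that is positive and finite excludes, eventually, both empty and infinite `F i`.
-/
theorem eventually_encard_of_tendsto (hB : Tendsto B l (vanHoveFilter μ)) (hd : d ≠ 0)
    (hratio : Tendsto (fun i => ((F i).encard : ℝ≥0∞) / μ (B i)) l (𝓝 (d : ℝ≥0∞))) :
    ∀ᶠ i in l, (F i).Finite ∧ (F i).Nonempty := by
  have h0 : ∀ᶠ i in l, 0 < ((F i).encard : ℝ≥0∞) / μ (B i) :=
    hratio.eventually_const_lt (by simpa using hd.bot_lt)
  have h1 : ∀ᶠ i in l, ((F i).encard : ℝ≥0∞) / μ (B i) < ⊤ :=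
    hratio.eventually_lt_const ENNReal.coe_lt_top
  filter_upwards [h0, h1, hB.eventually (eventually_measure_vanHoveFilter μ)] with i hi hi' hm
  constructor
  · by_contra hinf
    rw [Set.Infinite.encard_eq hinf, ENat.toENNReal_top, ENNReal.top_div_of_ne_top hm.2] at hi'
    exact lt_irrefl _ hi'
  · by_contra hemp
    rw [not_nonempty_iff_eq_empty] at hemp
    simp [hemp] at hi

variable [l.NeBot]

theorem limsup_logRate_covFibre_le (hOW : SatisfiesOrnsteinWeiss μ) (hp : IsFactorMap G p)
    (hB : Tendsto B l (vanHoveFilter μ)) (hd : d ≠ 0)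
    (hratio : Tendsto (fun i => ((F i).encard : ℝ≥0∞) / μ (B i)) l (𝓝 (d : ℝ≥0∞)))
    (hFB : ∀ᶠ i in l, F i ⊆ B i) {η : Set (X × X)} (hη : η ∈ 𝓝ˢ (diagonal X)) :
    limsup (fun i => logRate (covFibre p (bowenEntourage η (F i))) (F i).encard) l ≤
      relEntropyAt μ p η / ((d : ℝ) : EReal) := by
  have hV : (vanHoveFilter μ).NeBot := hB.neBot
  have hev := eventually_encard_of_tendsto hB hd hratio
  rcases isEmpty_or_nonempty X with hX | hX
  · have : ∀ᶠ i in l, logRate (covFibre p (bowenEntourage η (F i))) (F i).encard = ⊥ := by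
      filter_upwards [hev] with i hi
      rw [covFibre_of_isEmpty]
      exact logRate_zero (by simpa using hi.2.ne_empty) (by simpa using hi.1)
    rw [limsup_congr this]
    simp
  obtain ⟨L, hL, hlim, -⟩ := exists_relEntropyAt_eq_coe hOW hp hη
  have hr := (ENNReal.tendsto_toReal ENNReal.coe_ne_top).comp hratio
  have hq := (hlim.comp hB).div hr (by simpa using hd)
  rw [hL, ← EReal.coe_div]
  refine (limsup_le_limsup ?_).trans_eq (EReal.tendsto_coe.2 hq).limsup_eq
  filter_upwards [hev, hB.eventually (eventually_measure_vanHoveFilter μ), hFB,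
    hB.eventually (eventually_isCompact_vanHoveFilter μ)] with i hi hm hsub hc
  rw [logRate_covFibre_eq p hη hi.1.isCompact (by simpa using hi.1), EReal.coe_le_coe_iff]
  have hm' := ENNReal.toReal_pos hm.1 hm.2
  simp only [Pi.div_apply, Function.comp_apply, ENNReal.toReal_div]
  rw [div_div_div_cancel_right₀ hm'.ne']
  exact div_le_div_of_nonneg_right (logCov_mono p hη hi.1.isCompact hc.1 hsub)
    ENNReal.toReal_nonneg

variable [IsTopologicalGroup G] [T2Space G] [LocallyCompactSpace G] [BorelSpace G]
  {μ : Measure G} [μ.IsHaarMeasure] [μ.IsMulRightInvariant]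

/-- Cover `B` by `K F` and the boundary. The first part is `F` seen through `η_K`; the second has
logarithmic covering number of order `o(μ(B))`. -/
theorem le_liminf_logRate_covFibre (hOW : SatisfiesOrnsteinWeiss μ) (hp : IsFactorMap G p)
    (hB : Tendsto B l (vanHoveFilter μ)) (hd : d ≠ 0)
    (hratio : Tendsto (fun i => ((F i).encard : ℝ≥0∞) / μ (B i)) l (𝓝 (d : ℝ≥0∞)))
    {K K' : Set G} (hK : IsCompact K) (hK' : IsCompact K')
    (hBF : ∀ᶠ i in l, B i ⊆ K * F i ∪ kBoundary K' (B i))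
    {η : Set (X × X)} (hη : η ∈ 𝓝ˢ (diagonal X)) :
    relEntropyAt μ p η / ((d : ℝ) : EReal) ≤ liminf (fun i =>
      logRate (covFibre p (bowenEntourage (bowenEntourage η K) (F i))) (F i).encard) l := by
  have hV : (vanHoveFilter μ).NeBot := hB.neBot
  have hd0 : (0 : EReal) < ((d : ℝ) : EReal) := by exact_mod_cast hd.bot_lt
  have hev := eventually_encard_of_tendsto hB hd hratio
  rcases isEmpty_or_nonempty X with hX | hX
  · have h := (tendsto_logRate_of_isEmpty (μ := μ) p η).limsup_eq
    rw [relEntropyAt, h, EReal.bot_div_of_pos_ne_top hd0 (EReal.coe_ne_top _)]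
    exact bot_le
  obtain ⟨L, hL, hlim, -⟩ := exists_relEntropyAt_eq_coe hOW hp hη
  obtain ⟨V, c, hVc, hc, hV'⟩ := exists_logCov_le_measure μ hp hη
  have hr := (ENNReal.tendsto_toReal ENNReal.coe_ne_top).comp hratio
  -- The packing bound involves `V ∂_{K'} B ⊆ ∂_{V K'} B`, whence the index `V * K'`.
  have hbd := ((ENNReal.tendsto_toReal ENNReal.zero_ne_top).comp
    ((tendsto_kBoundary_vanHoveFilter μ (hVc.mul hK')).comp hB)).const_mul c
  have hq := ((hlim.comp hB).sub hbd).div hr (by simpa using hd)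
  rw [hL, ← EReal.coe_div]
  simp only [ENNReal.toReal_zero, mul_zero, sub_zero, ENNReal.coe_toReal] at hq
  refine (EReal.tendsto_coe.2 hq).liminf_eq.symm.trans_le (liminf_le_liminf ?_)
  filter_upwards [hev, hB.eventually (eventually_measure_vanHoveFilter μ), hBF,
    hB.eventually (eventually_isCompact_vanHoveFilter μ)] with i hi hm hsub hcB
  rw [logRate_covFibre_eq p (bowenEntourage_mem_nhdsSet hη hK) hi.1.isCompact
    (by simpa using hi.1), EReal.coe_le_coe_iff]
  have hm' := ENNReal.toReal_pos hm.1 hm.2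
  simp only [Pi.div_apply, Function.comp_apply, ENNReal.toReal_div]
  rw [mul_div_assoc', ← sub_div, div_div_div_cancel_right₀ hm'.ne']
  refine div_le_div_of_nonneg_right ?_ ENNReal.toReal_nonneg
  have h1 : logCov p (bowenEntourage η K) (F i) = logCov p η (K * F i) := by
    simp only [logCov, bowenEntourage_mul]
  have hKF := hK.mul hi.1.isCompact
  have hbc := hK'.kBoundary hcB.1
  have h2 := (logCov_mono p hη hcB.1 (hKF.union hbc) hsub).trans (logCov_union_le p hη hKF hbc)
  have h3 := hV' _ hbc
  have h4 : (μ (V * kBoundary K' (B i))).toReal ≤ (μ (kBoundary (V * K') (B i))).toReal :=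
    ENNReal.toReal_mono ((hVc.mul hK').kBoundary hcB.1).measure_lt_top.ne
      (measure_mono (mul_kBoundary_subset V K' (B i)))
  have h5 := mul_le_mul_of_nonneg_left h4 hc
  rw [h1]
  linarith

/-- The relative entropy can be computed along finite sets that approximate Van Hove sets, for every
counting function that is comparable to the covering numbers. -/
theorem relEntropy_eq_mul_iSup (hOW : SatisfiesOrnsteinWeiss μ) (hp : IsFactorMap G p)
    (hB : Tendsto B l (vanHoveFilter μ)) (hd : d ≠ 0)
    (hratio : Tendsto (fun i => ((F i).encard : ℝ≥0∞) / μ (B i)) l (𝓝 (d : ℝ≥0∞)))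
    (hFB : ∀ᶠ i in l, F i ⊆ B i)
    {K K' : Set G} (hK : IsCompact K) (hK' : IsCompact K')
    (hBF : ∀ᶠ i in l, B i ⊆ K * F i ∪ kBoundary K' (B i))
    {N : Set (X × X) → ℕ∞}
    (hN : ∀ η ∈ 𝓝ˢ (diagonal X), N η ≤ covFibre p η)
    (hN' : ∀ η ∈ 𝓝ˢ (diagonal X), ∃ θ ∈ 𝓝ˢ (diagonal X), ∀ F : Set G, F.Finite →
      covFibre p (bowenEntourage η F) ≤ N (bowenEntourage θ F)) :
    relEntropy μ p = ((d : ℝ) : EReal) * ⨆ η ∈ 𝓝ˢ (diagonal X),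
      liminf (fun i => logRate (N (bowenEntourage η (F i))) (F i).encard) l ∧
    relEntropy μ p = ((d : ℝ) : EReal) * ⨆ η ∈ 𝓝ˢ (diagonal X),
      limsup (fun i => logRate (N (bowenEntourage η (F i))) (F i).encard) l := by
  have hev := eventually_encard_of_tendsto hB hd hratio
  refine eq_mul_iSup_liminf_and_limsup hd (fun η hη => ?_) fun η hη => ?_
  · refine (limsup_le_limsup ?_).trans (limsup_logRate_covFibre_le hOW hp hB hd hratio hFB hη)
    filter_upwards [hev] with i hi
    exact logRate_mono (hN _ (bowenEntourage_mem_nhdsSet hη hi.1.isCompact)) _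
  · obtain ⟨θ, hθ, h⟩ := hN' _ (bowenEntourage_mem_nhdsSet hη hK)
    refine ⟨θ, hθ, (le_liminf_logRate_covFibre hOW hp hB hd hratio hK hK' hBF hη).trans
      (liminf_le_liminf ?_)⟩
    filter_upwards [hev] with i hi
    exact logRate_mono (h _ hi.1) _

end Discretisation

/-! ### Uniform density -/

section Density

theorem measure_mul_le_mul_encard {G : Type*} [Group G] [MeasurableSpace G] (μ : Measure G)
    [MeasurableMul G] [μ.IsMulRightInvariant]
    (K : Set G) {E : Set G} (hE : E.Finite) : μ (K * E) ≤ μ K * E.encard := by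
  lift E to Finset G using hE
  have h : K * (E : Set G) = ⋃ g ∈ E, K * {g} := by
    rw [← mul_iUnion₂]
    exact congrArg (K * ·) (biUnion_of_singleton (E : Set G)).symm
  rw [h]
  refine (measure_biUnion_finset_le E _).trans_eq ?_
  simp [mul_singleton, image_mul_right, measure_preimage_mul_right, mul_comm]

variable {G : Type u} [Group G] [TopologicalSpace G] [IsTopologicalGroup G] [T2Space G]
  [MeasurableSpace G] [BorelSpace G]

/-- Put `A' = (K⁻¹ ∪ {1}) A`. Then `A ⊆ K (A' ∩ Λ)`, so density zero would force `μ(A) < μ(A') / 2`,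
while the Van Hove property gives `μ(A') < 2 μ(A)`. -/
theorem IsRelativelyDense.density_ne_zero {μ : Measure G} [μ.IsHaarMeasure]
    [μ.IsMulRightInvariant] [(vanHoveFilter μ).NeBot] {Λ : Set G} (hΛ : IsRelativelyDense Λ)
    {d : ℝ≥0} (h : Tendsto (fun A : Set G => ((A ∩ Λ).encard : ℝ≥0∞) / μ A) (vanHoveFilter μ)
      (𝓝 (d : ℝ≥0∞))) : d ≠ 0 := by
  rintro rfl
  obtain ⟨K, hK, hKΛ⟩ := hΛ
  have hK' : IsCompact (insert 1 K⁻¹) := hK.inv.insert 1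
  have hlim := h.comp (tendsto_mul_vanHoveFilter μ hK' (mem_insert _ _))
  have hlim' := ENNReal.Tendsto.const_mul (a := μ K) hlim (.inr hK.measure_lt_top.ne)
  rw [ENNReal.coe_zero, mul_zero] at hlim'
  have hbd := tendsto_kBoundary_vanHoveFilter μ hK'
  obtain ⟨A, h0, h1, h2, hm, hA⟩ := ((hlim.eventually_lt_const ENNReal.coe_lt_top).and
    ((hlim'.eventually_lt_const (u := 2⁻¹) (by simp)).and
    ((hbd.eventually_lt_const one_pos).and ((eventually_measure_vanHoveFilter μ).and
      (eventually_isCompact_vanHoveFilter μ))))).exists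
  simp only [Function.comp_apply] at h0 h1
  set A' := insert 1 K⁻¹ * A
  have hA' : μ A' ≠ ⊤ := (hK'.mul hA.1).measure_lt_top.ne
  have hfin : (A' ∩ Λ).Finite := by
    by_contra hinf
    rw [Set.Infinite.encard_eq hinf, ENat.toENNReal_top, ENNReal.top_div_of_ne_top hA'] at h0
    exact lt_irrefl _ h0
  have hle : μ A ≤ μ K * (A' ∩ Λ).encard := by
    refine (measure_mono fun a ha => ?_).trans (measure_mul_le_mul_encard μ K hfin)
    obtain ⟨k, hk, l, hl, rfl⟩ : a ∈ K * Λ := hKΛ ▸ mem_univ a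
    refine ⟨k, hk, l, ⟨⟨k⁻¹, mem_insert_of_mem _ (inv_mem_inv.2 hk), _, ha, ?_⟩, hl⟩, rfl⟩
    simp
  have hle' : μ A' ≤ μ A + μ (kBoundary (insert 1 K⁻¹) A) :=
    (measure_mono (mul_subset_union_kBoundary (mem_insert _ _) A)).trans (measure_union_le _ _)
  have h3 : μ (kBoundary (insert 1 K⁻¹) A) < μ A := by
    rwa [ENNReal.div_lt_iff (.inl hm.1) (.inl hm.2), one_mul] at h2
  have hA0 : μ A' ≠ 0 := fun h => hm.1 (le_antisymm (h ▸ measure_mono fun a ha =>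
    ⟨1, mem_insert _ _, a, ha, one_mul a⟩) zero_le)
  rw [← mul_div_assoc, ENNReal.div_lt_iff (.inl hA0) (.inl hA')] at h1
  have h4 : μ A' < 2 * μ A := by
    rw [two_mul]
    exact hle'.trans_lt (ENNReal.add_lt_add_left hm.2 h3)
  have h5 : μ A < 2⁻¹ * μ A' := hle.trans_lt h1
  have h6 : 2 * μ A < μ A' := by
    have := ENNReal.mul_lt_mul_right (a := 2) two_ne_zero ENNReal.ofNat_ne_top h5
    rwa [← mul_assoc, ENNReal.mul_inv_cancel two_ne_zero ENNReal.ofNat_ne_top, one_mul] at this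
  exact lt_irrefl _ (h4.trans h6)

end Density

/-! ### Uniform lattices -/

section Lattice

variable {G : Type u} [Group G] [TopologicalSpace G] [IsTopologicalGroup G] [T2Space G]

theorem Subgroup.isClosed_image_coe (Λ : Subgroup G) [DiscreteTopology Λ] (E : Set Λ) :
    IsClosed ((↑) '' E : Set G) :=
  (Subgroup.isClosed_of_discrete (H := Λ)).isClosedEmbedding_subtypeVal.isClosedMap _
    (isClosed_discrete E)

theorem IsCompact.finite_preimage_coe (Λ : Subgroup G) [DiscreteTopology Λ] {A : Set G}
    (hA : IsCompact A) : ((↑) ⁻¹' A : Set Λ).Finite :=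
  ((Subgroup.isClosed_of_discrete (H := Λ)).isClosedEmbedding_subtypeVal.isCompact_preimage
    hA).finite_of_discrete

/-- `C` is a Borel set of representatives of the left cosets of `Λ`, contained in the compact
neighbourhood `W` of the identity. -/
structure IsPrecompactFundamentalDomain [MeasurableSpace G] (Λ : Subgroup G) (C W : Set G) :
    Prop where
  measurableSet : MeasurableSet C
  isCompact : IsCompact W
  mem_nhds : W ∈ 𝓝 (1 : G)
  subset : C ⊆ W
  exists_eq_mul : ∀ x : G, ∃ c ∈ C, ∃ l : Λ, x = c * l
  injective : ∀ c ∈ C, ∀ c' ∈ C, c⁻¹ * c' ∈ Λ → c = c'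

omit [T2Space G] in
-- Discreteness isolates `1` in `Λ` by a neighbourhood `U`, and continuity of `(v, w) ↦ v⁻¹ * w`
-- yields `V` with `V⁻¹ V ⊆ U`.
theorem exists_isOpen_inv_mul_mem_imp_eq (Λ : Subgroup G) [DiscreteTopology Λ] :
    ∃ V : Set G, IsOpen V ∧ 1 ∈ V ∧ ∀ v ∈ V, ∀ w ∈ V, v⁻¹ * w ∈ Λ → v = w := by
  have h1 : {(1 : Λ)} ∈ 𝓝 (1 : Λ) := isOpen_discrete _ |>.mem_nhds rfl
  rw [nhds_subtype_eq_comap] at h1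
  obtain ⟨U, hU, hUΛ⟩ := h1
  have hc : Continuous fun q : G × G => q.1⁻¹ * q.2 := by fun_prop
  have h2 : (fun q : G × G => q.1⁻¹ * q.2) ⁻¹' U ∈ 𝓝 ((1, 1) : G × G) :=
    hc.continuousAt (by simpa using hU)
  obtain ⟨V₁, V₂, hV₁, h1V₁, hV₂, h1V₂, hV⟩ := mem_nhds_prod_iff'.1 h2
  refine ⟨V₁ ∩ V₂, hV₁.inter hV₂, ⟨h1V₁, h1V₂⟩, fun v hv w hw hvw => ?_⟩
  have h3 : v⁻¹ * w ∈ U := hV (show (v, w) ∈ V₁ ×ˢ V₂ from ⟨hv.1, hw.2⟩)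
  have h4 : (⟨v⁻¹ * w, hvw⟩ : Λ) = 1 := hUΛ h3
  exact (inv_mul_eq_one.1 (congrArg Subtype.val h4))

variable [MeasurableSpace G] [BorelSpace G]

omit [T2Space G] in
-- Greedy construction: from each new translate `g V` remove the cosets already represented. Their
-- union is open, so the set stays Borel.
theorem exists_measurableSet_representatives (Λ : Subgroup G) {V : Set G} (hVo : IsOpen V)
    (hV : ∀ v ∈ V, ∀ w ∈ V, v⁻¹ * w ∈ Λ → v = w) (t : Finset G) :
    ∃ C : Set G, MeasurableSet C ∧ C ⊆ (t : Set G) * V ∧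
      (∀ x ∈ (t : Set G) * V, ∃ c ∈ C, ∃ l : Λ, x = c * l) ∧
      ∀ c ∈ C, ∀ c' ∈ C, c⁻¹ * c' ∈ Λ → c = c' := by
  classical
  induction t using Finset.induction_on with
  | empty => exact ⟨∅, MeasurableSet.empty, by simp, by simp, by simp⟩
  | insert g t _ ih =>
    obtain ⟨C, hC, hCt, hcov, hinj⟩ := ih
    have hopen : IsOpen ((t : Set G) * V * (Λ : Set G)) := (hVo.mul_left).mul_right
    refine ⟨C ∪ ({g} * V) \ ((t : Set G) * V * (Λ : Set G)),
      hC.union (hVo.mul_left.measurableSet.diff hopen.measurableSet), ?_, ?_, ?_⟩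
    · rw [Finset.coe_insert, insert_eq, union_mul]
      exact union_subset (hCt.trans subset_union_right) (sdiff_subset.trans subset_union_left)
    · rw [Finset.coe_insert, insert_eq, union_mul]
      rintro x (hx | hx)
      · by_cases hxt : x ∈ (t : Set G) * V * (Λ : Set G)
        · obtain ⟨y, hy, l, hl, rfl⟩ := hxt
          obtain ⟨c, hc, l', rfl⟩ := hcov y hy
          exact ⟨c, .inl hc, l' * ⟨l, hl⟩, by simp [mul_assoc]⟩
        · exact ⟨x, .inr ⟨hx, hxt⟩, 1, by simp⟩
      · obtain ⟨c, hc, l, rfl⟩ := hcov x hx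
        exact ⟨c, .inl hc, l, rfl⟩
    · have key : ∀ c ∈ C, ∀ c' ∉ (t : Set G) * V * (Λ : Set G), c⁻¹ * c' ∉ Λ :=
        fun c hc c' hc' h => hc' ⟨c, hCt hc, _, h, by simp⟩
      rintro c (hc | hc) c' (hc' | hc') h
      · exact hinj c hc c' hc' h
      · exact absurd h (key c hc c' hc'.2)
      · refine absurd ?_ (key c' hc' c hc.2)
        simpa using Λ.inv_mem h
      · obtain ⟨_, rfl, v, hv, rfl⟩ := hc.1
        obtain ⟨_, rfl, w, hw, rfl⟩ := hc'.1
        simp only [mul_inv_rev, mul_assoc, inv_mul_cancel_left] at h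
        rw [hV v hv w hw h]

omit [T2Space G] in
theorem IsUniformLattice.exists_isPrecompactFundamentalDomain [LocallyCompactSpace G]
    {Λ : Subgroup G} (hΛ : IsUniformLattice Λ) :
    ∃ C W : Set G, IsPrecompactFundamentalDomain Λ C W := by
  have := hΛ.discrete
  have := hΛ.cocompact
  obtain ⟨U, hUo, h1U, hU⟩ := exists_isOpen_inv_mul_mem_imp_eq Λ
  obtain ⟨Q, hQ, hQ1⟩ := exists_compact_mem_nhds (1 : G)
  set V := U ∩ interior Q with hVdef
  have hVo : IsOpen V := hUo.inter isOpen_interior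
  have h1V : 1 ∈ V := ⟨h1U, mem_interior_iff_mem_nhds.2 hQ1⟩
  obtain ⟨t, ht⟩ := (isCompact_univ (X := G ⧸ Λ)).elim_finite_subcover
    (fun g : G => ((↑) : G → G ⧸ Λ) '' ({g} * V))
    (fun g => QuotientGroup.isOpenMap_coe _ hVo.mul_left) (fun q _ => by
      obtain ⟨g, rfl⟩ := QuotientGroup.mk_surjective q
      exact mem_iUnion.2 ⟨g, g, ⟨g, rfl, 1, h1V, mul_one g⟩, rfl⟩)
  obtain ⟨C, hC, hCt, hcov, hinj⟩ := exists_measurableSet_representatives Λ hVo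
    (fun v hv w hw => hU v hv.1 w hw.1) t
  -- The summand `Q` only serves to make `W` a neighbourhood of `1`.
  refine ⟨C, Q ∪ (t : Set G) * Q, hC, hQ.union (t.finite_toSet.isCompact.mul hQ),
    mem_of_superset hQ1 subset_union_left, ?_, fun x => ?_, hinj⟩
  · exact (hCt.trans (mul_subset_mul_left (inter_subset_right.trans interior_subset))).trans
      subset_union_right
  · obtain ⟨g, hg, y, hy, hyx⟩ := mem_iUnion₂.1 (ht (mem_univ (x : G ⧸ Λ)))
    obtain ⟨c, hc, l, rfl⟩ := hcov y (mul_subset_mul_right (singleton_subset_iff.2 hg) hy)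
    have h := QuotientGroup.eq.1 hyx
    refine ⟨c, hc, l * ⟨_, h⟩, ?_⟩
    simp [mul_assoc]

omit [IsTopologicalGroup G] [T2Space G] in
theorem count_eq_encard (Λ : Subgroup G) [DiscreteTopology Λ] (E : Set Λ) :
    (Measure.count : Measure Λ) E = E.encard :=
  Measure.count_apply (isOpen_discrete E).measurableSet

namespace IsPrecompactFundamentalDomain

variable {Λ : Subgroup G} {C W : Set G}

omit [IsTopologicalGroup G] [T2Space G] [BorelSpace G] in
theorem one_mem (h : IsPrecompactFundamentalDomain Λ C W) : 1 ∈ W := mem_of_mem_nhds h.mem_nhds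

omit [IsTopologicalGroup G] [T2Space G] [BorelSpace G] in
-- From `c * l = x * e` follows `l * e⁻¹ = c⁻¹ * x ∈ W⁻¹ L`. This transfers thickenings in `G` to
-- thickenings in `Λ`.
theorem mem_mul_of_mul_mem (h : IsPrecompactFundamentalDomain Λ C W) {L : Set G} {E : Set Λ}
    {c : G} (hc : c ∈ C) {l : Λ} (hl : c * l ∈ L * ((↑) '' E : Set G)) :
    l ∈ ((↑) ⁻¹' (W⁻¹ * L) : Set Λ) * E := by
  obtain ⟨x, hx, _, ⟨e, he, rfl⟩, heq⟩ := hl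
  refine ⟨l * e⁻¹, ⟨c⁻¹, inv_mem_inv.2 (h.subset hc), x, hx, ?_⟩, e, he, by simp⟩
  simp only at heq ⊢
  rw [inv_mul_eq_iff_eq_mul, eq_comm, Subgroup.coe_mul, ← mul_assoc, ← heq]
  simp

omit [IsTopologicalGroup G] [T2Space G] [BorelSpace G] in
theorem subset_mul (h : IsPrecompactFundamentalDomain Λ C W) (A : Set G) :
    A ⊆ C * ((↑) '' ((↑) ⁻¹' (W⁻¹ * A) : Set Λ)) := by
  intro a ha
  obtain ⟨c, hc, l, rfl⟩ := h.exists_eq_mul a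
  exact ⟨c, hc, l, ⟨l, ⟨c⁻¹, inv_mem_inv.2 (h.subset hc), _, ha, by simp⟩, rfl⟩, rfl⟩

omit [IsTopologicalGroup G] [T2Space G] [BorelSpace G] in
theorem mul_image_subset (h : IsPrecompactFundamentalDomain Λ C W) (D : Set Λ) :
    W * ((↑) '' D : Set G) ⊆
      C * ((↑) '' (D ∪ kBoundary ((↑) ⁻¹' (W⁻¹ * W)) D)) := by
  intro x hx
  obtain ⟨c, hc, l, rfl⟩ := h.exists_eq_mul x
  have h1 : (1 : Λ) ∈ ((↑) ⁻¹' (W⁻¹ * W) : Set Λ) :=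
    mem_mul.2 ⟨1, by simpa using h.one_mem, 1, h.one_mem, by simp⟩
  exact ⟨c, hc, l, ⟨l, mul_subset_union_kBoundary h1 D (h.mem_mul_of_mul_mem hc hx), rfl⟩, rfl⟩

variable {μ : Measure G} [μ.IsMulRightInvariant]

omit [T2Space G] in
-- The translates `C l` are disjoint, since an element of two of them gives two representatives of
-- one coset; right invariance gives them equal measure.
theorem measure_mul (h : IsPrecompactFundamentalDomain Λ C W) {E : Set Λ} (hE : E.Finite) :
    μ (C * ((↑) '' E)) = μ C * E.encard := by
  lift E to Finset Λ using hE
  have hU : C * ((↑) '' (E : Set Λ)) = ⋃ l ∈ E, C * {(l : G)} := by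
    ext x
    simp only [Set.mem_mul, mem_iUnion, mem_image]
    constructor
    · rintro ⟨c, hc, _, ⟨l, hl, rfl⟩, rfl⟩
      exact ⟨l, hl, c, hc, l, rfl, rfl⟩
    · rintro ⟨l, hl, c, hc, _, rfl, rfl⟩
      exact ⟨c, hc, l, ⟨l, hl, rfl⟩, rfl⟩
  have hmeas : ∀ l : Λ, MeasurableSet (C * {(l : G)}) := fun l => by
    rw [mul_singleton, image_mul_right]
    exact measurable_mul_const _ h.measurableSet
  rw [hU, measure_biUnion_finset ?_ fun l _ => hmeas l]
  · simp [mul_singleton, image_mul_right, measure_preimage_mul_right, mul_comm]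
  · intro l _ l' _ hne
    refine Set.disjoint_left.2 ?_
    rintro _ ⟨c, hc, _, rfl, rfl⟩ ⟨c', hc', _, rfl, heq⟩
    simp only at heq
    have hcc : c' = c := by
      refine h.injective c' hc' c hc ?_
      have : c'⁻¹ * c = l' * (l : G)⁻¹ := by
        rw [inv_mul_eq_iff_eq_mul, ← mul_assoc, heq, mul_inv_cancel_right]
      rw [this]
      exact (l' * l⁻¹).2
    rw [hcc] at heq
    exact hne (Subtype.ext (mul_left_cancel heq).symm)

omit [T2Space G] in
theorem le_measure_mul_image (h : IsPrecompactFundamentalDomain Λ C W) {D : Set Λ}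
    (hD : D.Finite) : μ C * D.encard ≤ μ (W * ((↑) '' D : Set G)) := by
  rw [← h.measure_mul hD]
  exact measure_mono (mul_subset_mul_right h.subset)

variable [μ.IsHaarMeasure]

omit [IsTopologicalGroup G] [T2Space G] [BorelSpace G] [μ.IsMulRightInvariant] in
theorem measure_ne_top (h : IsPrecompactFundamentalDomain Λ C W) : μ C ≠ ⊤ :=
  ne_top_of_le_ne_top h.isCompact.measure_lt_top.ne (measure_mono h.subset)

/-- Finitely many translates of `C` cover `W`, which has positive measure. -/
theorem measure_ne_zero [DiscreteTopology Λ] (h : IsPrecompactFundamentalDomain Λ C W) :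
    μ C ≠ 0 := by
  intro h0
  have h1 := measure_mono (μ := μ) (h.subset_mul W)
  rw [h.measure_mul ((h.isCompact.inv.mul h.isCompact).finite_preimage_coe Λ), h0, zero_mul] at h1
  exact (μ.measure_pos_of_mem_nhds h.mem_nhds).not_ge h1

variable [DiscreteTopology Λ]

omit [μ.IsHaarMeasure] in
theorem measure_mul_encard_preimage_le (h : IsPrecompactFundamentalDomain Λ C W) {A : Set G}
    (hA : IsCompact A) : μ C * ((↑) ⁻¹' A : Set Λ).encard ≤ μ (W * A) := by
  rw [← h.measure_mul (hA.finite_preimage_coe Λ)]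
  exact measure_mono (mul_subset_mul h.subset (image_preimage_subset _ _))

/-- Tiling by translates of `C` places `μ(C) |A ∩ Λ|` between `μ(A) - μ(∂_{W W⁻¹} A)` and `μ(A) +
μ(∂_W A)`. -/
theorem tendsto_encard_preimage (h : IsPrecompactFundamentalDomain Λ C W) :
    Tendsto (fun A : Set G => (((↑) ⁻¹' A : Set Λ).encard : ℝ≥0∞) / μ A) (vanHoveFilter μ)
      (𝓝 (μ C)⁻¹) := by
  have hW := h.isCompact
  have hlow : Tendsto (fun A => 1 - μ (kBoundary (W * W⁻¹) A) / μ A) (vanHoveFilter μ) (𝓝 1) := by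
    simpa using ENNReal.Tendsto.sub tendsto_const_nhds
      (tendsto_kBoundary_vanHoveFilter μ (hW.mul hW.inv)) (.inl ENNReal.one_ne_top)
  have hupp : Tendsto (fun A => 1 + μ (kBoundary W A) / μ A) (vanHoveFilter μ) (𝓝 1) := by
    simpa using tendsto_const_nhds.add (tendsto_kBoundary_vanHoveFilter μ hW)
  have key : Tendsto (fun A : Set G => μ C * ((((↑) ⁻¹' A : Set Λ).encard : ℝ≥0∞) / μ A))
      (vanHoveFilter μ) (𝓝 1) := by
    refine tendsto_of_tendsto_of_tendsto_of_le_of_le' hlow hupp ?_ ?_ <;>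
      filter_upwards [eventually_isCompact_vanHoveFilter μ, eventually_measure_vanHoveFilter μ]
        with A hA hm
    · rw [tsub_le_iff_right, ← mul_div_assoc, ← ENNReal.add_div,
        ENNReal.le_div_iff_mul_le (.inl hm.1) (.inl hm.2), one_mul]
      have hb := hW.inv.kBoundary hA.1
      calc μ A ≤ μ (C * ((↑) '' ((↑) ⁻¹' (A ∪ kBoundary W⁻¹ A) : Set Λ))) :=
            measure_mono ((h.subset_mul A).trans (mul_subset_mul_left (image_mono
              (preimage_mono (mul_subset_union_kBoundary (by simpa using h.one_mem) A)))))
        _ ≤ μ (C * ((↑) '' ((↑) ⁻¹' A : Set Λ))) +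
              μ (C * ((↑) '' ((↑) ⁻¹' (kBoundary W⁻¹ A) : Set Λ))) := by
            rw [preimage_union, image_union, mul_union]
            exact measure_union_le _ _
        _ ≤ _ := by
            refine add_le_add (h.measure_mul (hA.1.finite_preimage_coe Λ)).le (measure_mono ?_)
            exact (mul_subset_mul h.subset (image_preimage_subset _ _)).trans
              (mul_kBoundary_subset _ _ _)
    · rw [← mul_div_assoc, ENNReal.div_le_iff hm.1 hm.2, add_mul, one_mul,
        ENNReal.div_mul_cancel hm.1 hm.2]
      exact (h.measure_mul_encard_preimage_le hA.1).trans ((measure_mono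
        (mul_subset_union_kBoundary h.one_mem A)).trans (measure_union_le _ _))
  have := ENNReal.Tendsto.const_mul (a := (μ C)⁻¹) key
    (.inr (ENNReal.inv_ne_top.2 h.measure_ne_zero))
  simpa only [← mul_assoc, ENNReal.inv_mul_cancel h.measure_ne_zero h.measure_ne_top, one_mul,
    mul_one] using this

/-- Traces of Van Hove sets on a uniform lattice are Van Hove sets of the lattice. -/
theorem tendsto_preimage_vanHoveFilter (h : IsPrecompactFundamentalDomain Λ C W) :
    Tendsto (fun A : Set G => ((↑) ⁻¹' A : Set Λ)) (vanHoveFilter μ)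
      (vanHoveFilter Measure.count) := by
  have hlim := h.tendsto_encard_preimage (μ := μ)
  have hinv0 : (μ C)⁻¹ ≠ 0 := ENNReal.inv_ne_zero.2 h.measure_ne_top
  have hinvt : (μ C)⁻¹ ≠ ⊤ := ENNReal.inv_ne_top.2 h.measure_ne_zero
  refine (tendsto_vanHoveFilter_iff _).2 ⟨?_, fun T hT => ?_⟩
  · filter_upwards [eventually_isCompact_vanHoveFilter μ,
      hlim.eventually_const_lt (ENNReal.inv_pos.2 h.measure_ne_top)] with A hA hpos
    refine ⟨(hA.1.finite_preimage_coe Λ).isCompact, ?_⟩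
    rw [(isOpen_discrete _).interior_eq, nonempty_iff_ne_empty]
    intro hemp
    simp [hemp] at hpos
  · have hT' : IsCompact ((↑) '' T : Set G) := hT.image continuous_subtype_val
    have hbd := tendsto_kBoundary_vanHoveFilter μ (h.isCompact.mul hT')
    have hq := ENNReal.Tendsto.const_mul (a := (μ C)⁻¹)
      (ENNReal.Tendsto.div hbd (.inr hinv0) hlim (.inl hinvt)) (.inr hinvt)
    rw [ENNReal.zero_div, mul_zero] at hq
    refine tendsto_of_tendsto_of_tendsto_of_le_of_le' tendsto_const_nhds hq
      (.of_forall fun _ => zero_le) ?_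
    filter_upwards [eventually_isCompact_vanHoveFilter μ, eventually_measure_vanHoveFilter μ]
        with A hA hm
    rw [count_eq_encard, count_eq_encard]
    have hsub : kBoundary T ((↑) ⁻¹' A : Set Λ) ⊆ (↑) ⁻¹' (kBoundary ((↑) '' T : Set G) A) := by
      simp only [kBoundary, closure_discrete]
      rintro _ ⟨⟨s, hs, a, ha, rfl⟩, ⟨t, ht, b, hb, heq⟩⟩
      exact ⟨⟨s, ⟨s, hs, rfl⟩, a, subset_closure ha, rfl⟩,
        ⟨t, ⟨t, ht, rfl⟩, b, subset_closure hb, congrArg Subtype.val heq⟩⟩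
    have h1 : μ C * (kBoundary T ((↑) ⁻¹' A : Set Λ)).encard ≤
        μ (kBoundary (W * ((↑) '' T : Set G)) A) :=
      (mul_le_mul_right (ENat.toENNReal_mono (encard_le_encard hsub)) _).trans
        ((h.measure_mul_encard_preimage_le (hT'.kBoundary hA.1)).trans
          (measure_mono (mul_kBoundary_subset _ _ _)))
    have h2 : ((kBoundary T ((↑) ⁻¹' A : Set Λ)).encard : ℝ≥0∞) ≤
        (μ C)⁻¹ * μ (kBoundary (W * ((↑) '' T : Set G)) A) := by
      rw [mul_comm, ← div_eq_mul_inv,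
        ENNReal.le_div_iff_mul_le (.inl h.measure_ne_zero) (.inl h.measure_ne_top), mul_comm]
      exact h1
    refine (ENNReal.div_le_div_right h2 _).trans_eq ?_
    rw [mul_div_assoc, div_eq_mul_inv _ (μ A), div_eq_mul_inv _ (μ A),
      ENNReal.mul_div_mul_right _ _ (ENNReal.inv_ne_zero.2 hm.2) (ENNReal.inv_ne_top.2 hm.1)]

omit [BorelSpace G] in
-- The closure of the complement of `W D` lies in the closed set `W Dᶜ`. So for a boundary point `c
-- * l`, the lattice part `l` is close to both `D` and `Dᶜ`.
theorem kBoundary_mul_image_subset (h : IsPrecompactFundamentalDomain Λ C W) (K : Set G)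
    (D : Set Λ) : kBoundary K (W * ((↑) '' D : Set G)) ⊆
      C * ((↑) '' (kBoundary ((↑) ⁻¹' (W⁻¹ * (K * W))) D)) := by
  have hcompl : closure (W * ((↑) '' D : Set G))ᶜ ⊆ W * ((↑) '' Dᶜ : Set G) := by
    refine closure_minimal (fun x hx => ?_)
      ((Λ.isClosed_image_coe Dᶜ).mul_left_of_isCompact h.isCompact)
    obtain ⟨c, hc, l, rfl⟩ := h.exists_eq_mul x
    exact ⟨c, h.subset hc, l, ⟨l, fun hl => hx ⟨c, h.subset hc, l, ⟨l, hl, rfl⟩, rfl⟩, rfl⟩, rfl⟩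
  have hclos : closure (W * ((↑) '' D : Set G)) = W * ((↑) '' D : Set G) :=
    ((Λ.isClosed_image_coe D).mul_left_of_isCompact h.isCompact).closure_eq
  rintro x ⟨hx, hx'⟩
  rw [hclos, ← mul_assoc] at hx
  replace hx' := mul_subset_mul_left hcompl hx'
  rw [← mul_assoc] at hx'
  obtain ⟨c, hc, l, rfl⟩ := h.exists_eq_mul x
  refine ⟨c, hc, l, ⟨l, ⟨?_, ?_⟩, rfl⟩, rfl⟩
  · exact mul_subset_mul_left subset_closure (h.mem_mul_of_mul_mem hc hx)
  · exact mul_subset_mul_left subset_closure (h.mem_mul_of_mul_mem hc hx')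

omit [BorelSpace G] [μ.IsHaarMeasure] [T2Space G] [IsTopologicalGroup G] [μ.IsMulRightInvariant] in
theorem eventually_finite_nonempty : ∀ᶠ D in vanHoveFilter (Measure.count : Measure Λ),
    D.Finite ∧ D.Nonempty :=
  (eventually_isCompact_vanHoveFilter _).mono fun _ hD =>
    ⟨hD.1.finite_of_discrete, hD.2.mono interior_subset⟩

/-- Thickened Van Hove sets of a uniform lattice are Van Hove sets of the group. -/
theorem tendsto_mul_image_vanHoveFilter (h : IsPrecompactFundamentalDomain Λ C W) :
    Tendsto (fun D : Set Λ => W * ((↑) '' D : Set G)) (vanHoveFilter Measure.count)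
      (vanHoveFilter μ) := by
  refine (tendsto_vanHoveFilter_iff _).2 ⟨?_, fun K hK => ?_⟩
  · filter_upwards [eventually_finite_nonempty (Λ := Λ)] with D hD
    refine ⟨h.isCompact.mul (hD.1.image _).isCompact, ?_⟩
    obtain ⟨l, hl⟩ := hD.2
    refine ⟨1 * l, (interior_maximal (mul_subset_mul_right interior_subset)
      isOpen_interior.mul_right) ?_⟩
    exact mul_mem_mul (mem_interior_iff_mem_nhds.2 h.mem_nhds) ⟨l, hl, rfl⟩
  · have hT : IsCompact ((↑) ⁻¹' (W⁻¹ * (K * W)) : Set Λ) :=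
      ((h.isCompact.inv.mul (hK.mul h.isCompact)).finite_preimage_coe Λ).isCompact
    refine tendsto_of_tendsto_of_tendsto_of_le_of_le' tendsto_const_nhds
      (tendsto_kBoundary_vanHoveFilter _ hT) (.of_forall fun _ => zero_le) ?_
    filter_upwards [eventually_finite_nonempty (Λ := Λ)] with D hD
    have hfin := (hT.kBoundary hD.1.isCompact).finite_of_discrete
    -- Scaling numerator and denominator by `μ(C)` turns cardinalities into Haar measures.
    rw [count_eq_encard, count_eq_encard,
      ← ENNReal.mul_div_mul_left (Set.encard _ : ℝ≥0∞) _ (h.measure_ne_zero (μ := μ))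
        h.measure_ne_top,
      ← h.measure_mul hfin]
    exact ENNReal.div_le_div (measure_mono (h.kBoundary_mul_image_subset K D))
      (h.le_measure_mul_image hD.1)

/-- `W D` contains `C D` and exceeds it by at most `C` times a lattice boundary of `D`, so `μ(W D) /
|D| → μ(C)`. -/
theorem tendsto_encard_div_measure_mul_image (h : IsPrecompactFundamentalDomain Λ C W) :
    Tendsto (fun D : Set Λ => (((↑) '' D : Set G).encard : ℝ≥0∞) / μ (W * ((↑) '' D : Set G)))
      (vanHoveFilter Measure.count) (𝓝 (μ C)⁻¹) := by
  have hS : IsCompact ((↑) ⁻¹' (W⁻¹ * W) : Set Λ) :=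
    ((h.isCompact.inv.mul h.isCompact).finite_preimage_coe Λ).isCompact
  have hbd := ENNReal.Tendsto.const_mul (a := μ C)
    (tendsto_kBoundary_vanHoveFilter Measure.count hS)
    (.inr h.measure_ne_top)
  have hupp := (tendsto_const_nhds (x := μ C)).add hbd
  rw [mul_zero, add_zero] at hupp
  have key : Tendsto (fun D : Set Λ => μ (W * ((↑) '' D : Set G)) / D.encard)
      (vanHoveFilter Measure.count) (𝓝 (μ C)) := by
    refine tendsto_of_tendsto_of_tendsto_of_le_of_le' tendsto_const_nhds hupp ?_ ?_ <;>
      filter_upwards [eventually_finite_nonempty (Λ := Λ)] with D hD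
    all_goals
      have h0 : (D.encard : ℝ≥0∞) ≠ 0 := by simpa using hD.2.ne_empty
      have ht : (D.encard : ℝ≥0∞) ≠ ⊤ := by simpa using hD.1
    · rw [ENNReal.le_div_iff_mul_le (.inl h0) (.inl ht)]
      exact h.le_measure_mul_image hD.1
    · have hfin := (hS.kBoundary hD.1.isCompact).finite_of_discrete
      rw [ENNReal.div_le_iff h0 ht, add_mul, count_eq_encard, count_eq_encard, mul_assoc,
        ENNReal.div_mul_cancel h0 ht, ← h.measure_mul hfin, ← h.measure_mul hD.1]
      refine (measure_mono (h.mul_image_subset D)).trans ?_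
      rw [image_union, mul_union]
      exact measure_union_le _ _
  refine (tendsto_inv_iff.2 key).congr' ?_
  filter_upwards [eventually_finite_nonempty (Λ := Λ)] with D hD
  rw [Subtype.val_injective.encard_image, ENNReal.inv_div (.inl (by simpa using hD.1))
    (.inl (by simpa using hD.2.ne_empty))]

end IsPrecompactFundamentalDomain

end Lattice

/-- Separation, spanning and covering numbers are comparable on finite Bowen entourages. -/
theorem comparable_covFibre {G : Type u} [Group G] [TopologicalSpace G] {X Y : Type*}
    [TopologicalSpace X] [CompactSpace X] [T2Space X] [MulAction G X] [ContinuousSMul G X]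
    (p : X → Y) {N : Set (X × X) → ℕ∞}
    (hN : N ∈ ({covFibre p, sepFibre p, spaFibre p} : Set (Set (X × X) → ℕ∞))) :
    (∀ η ∈ 𝓝ˢ (diagonal X), N η ≤ covFibre p η) ∧
      ∀ η ∈ 𝓝ˢ (diagonal X), ∃ θ ∈ 𝓝ˢ (diagonal X), ∀ F : Set G, F.Finite →
        covFibre p (bowenEntourage η F) ≤ N (bowenEntourage θ F) := by
  rcases hN with rfl | rfl | rfl
  · exact ⟨fun _ _ => le_rfl, fun η hη => ⟨η, hη, fun _ _ => le_rfl⟩⟩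
  · refine ⟨fun η _ => sepFibre_le_covFibre p η, fun η hη => ?_⟩
    obtain ⟨θ, hθ, h⟩ := exists_covFibre_le_spaFibre G p hη
    exact ⟨θ, hθ, fun F hF => (h F hF).trans
      (spaFibre_le_sepFibre p (bowenEntourage_mem_nhdsSet hθ hF.isCompact))⟩
  · exact ⟨fun η hη => (spaFibre_le_sepFibre p hη).trans (sepFibre_le_covFibre p η),
      fun η hη => exists_covFibre_le_spaFibre G p hη⟩

/-- The relative entropy of the action of a group along Van Hove sets of a uniform lattice. -/
theorem IsPrecompactFundamentalDomain.relEntropy_eq_mul_iSup {G : Type u} [Group G]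
    [TopologicalSpace G] [IsTopologicalGroup G] [T2Space G] [LocallyCompactSpace G]
    [MeasurableSpace G] [BorelSpace G] {μ : Measure G} [μ.IsHaarMeasure] [μ.IsMulRightInvariant]
    {Λ : Subgroup G} [DiscreteTopology Λ] {C W : Set G} (h : IsPrecompactFundamentalDomain Λ C W)
    {X Y : Type*} [TopologicalSpace X] [CompactSpace X] [MulAction G X] [ContinuousSMul G X]
    [TopologicalSpace Y] [MulAction G Y] {p : X → Y} (hOW : SatisfiesOrnsteinWeiss μ)
    (hp : IsFactorMap G p) {d : ℝ≥0} (hd : (d : ℝ≥0∞) = (μ C)⁻¹) {ι : Type*} {l : Filter ι}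
    [l.NeBot] {D : ι → Set Λ} (hD : Tendsto D l (vanHoveFilter Measure.count)) :
    relEntropy μ p = ((d : ℝ) : EReal) * ⨆ η ∈ 𝓝ˢ (diagonal X),
      liminf (fun j => logRate (covFibre p (bowenEntourage η (D j))) (D j).encard) l ∧
    relEntropy μ p = ((d : ℝ) : EReal) * ⨆ η ∈ 𝓝ˢ (diagonal X),
      limsup (fun j => logRate (covFibre p (bowenEntourage η (D j))) (D j).encard) l := by
  have hd0 : d ≠ 0 := by
    rintro rfl
    exact ENNReal.inv_ne_zero.2 (h.measure_ne_top (μ := μ)) (by simpa using hd.symm)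
  have hB : Tendsto (fun j => W * (Subtype.val '' D j : Set G)) l (vanHoveFilter μ) :=
    (h.tendsto_mul_image_vanHoveFilter (μ := μ)).comp hD
  have hratio : Tendsto (fun j => ((Subtype.val '' D j : Set G).encard : ℝ≥0∞) /
      μ (W * (Subtype.val '' D j : Set G))) l (𝓝 (d : ℝ≥0∞)) := by
    rw [hd]
    exact h.tendsto_encard_div_measure_mul_image.comp hD
  have hsub : ∀ j, (Subtype.val '' D j : Set G) ⊆ W * (Subtype.val '' D j : Set G) :=
    fun j x hx => ⟨1, h.one_mem, x, hx, one_mul x⟩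
  -- Here `B = W D` equals `K F` for `K = W`, so no boundary term is needed and `K' = ∅`.
  have key := _root_.relEntropy_eq_mul_iSup hOW hp hB hd0 hratio (.of_forall hsub) h.isCompact
    isCompact_empty (.of_forall fun j => subset_union_left) (N := covFibre p)
    (fun _ _ => le_rfl) fun η hη => ⟨η, hη, fun _ _ => le_rfl⟩
  simpa only [bowenEntourage_image_subtype, Subtype.val_injective.encard_image] using key

theorem mainTheorem4
    {G : Type u} [Group G] [TopologicalSpace G] [IsTopologicalGroup G] [T2Space G]
    [LocallyCompactSpace G] [MeasurableSpace G] [BorelSpace G]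
    (μ : Measure G) [μ.IsHaarMeasure] [μ.IsMulRightInvariant] [μ.Regular]
    (hOW : SatisfiesOrnsteinWeiss μ)
    {X : Type*} [TopologicalSpace X] [CompactSpace X] [T2Space X]
    [MulAction G X] [ContinuousSMul G X]
    {Y : Type*} [TopologicalSpace Y] [MulAction G Y] [ContinuousSMul G Y]
    (p : X → Y) (hp : IsFactorMap G p)
    {I : Type*} [PartialOrder I] [IsDirectedOrder I] [Nonempty I]
    (A : I → Set G) (hA : IsVanHoveNet μ A) :
    -- the limits that define the relative entropy exist along the given net
    (∀ η ∈ 𝓝ˢ (diagonal X),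
      Tendsto (fun i => logRate (covFibre p (bowenEntourage η (A i))) (μ (A i))) atTop
        (𝓝 (relEntropyAt μ p η))) ∧
    -- relatively dense sets with a well defined uniform density
    (∀ (Λ : Set G) (d : ℝ≥0), IsRelativelyDense Λ → HasUniformDensity μ Λ d →
      ∀ N ∈ ({covFibre p, sepFibre p, spaFibre p} : Set (Set (X × X) → ℕ∞)),
        relEntropy μ p = ((d : ℝ) : EReal) * ⨆ η ∈ 𝓝ˢ (diagonal X),
          liminf (fun i => logRate (N (bowenEntourage η (A i ∩ Λ))) (A i ∩ Λ).encard) atTop ∧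
        relEntropy μ p = ((d : ℝ) : EReal) * ⨆ η ∈ 𝓝ˢ (diagonal X),
          limsup (fun i => logRate (N (bowenEntourage η (A i ∩ Λ))) (A i ∩ Λ).encard) atTop) ∧
    -- uniform lattices, for the restricted actions and the counting measure
    (∀ Λ : Subgroup G, IsUniformLattice Λ →
      ∃ d : ℝ≥0, HasUniformDensity μ (Λ : Set G) d ∧
        relEntropy μ p = ((d : ℝ) : EReal) * relEntropy (Measure.count : Measure Λ) p ∧
        ∀ (J : Type u) [PartialOrder J] [IsDirectedOrder J] [Nonempty J] (D : J → Set Λ),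
          IsVanHoveNet (Measure.count : Measure Λ) D →
            relEntropy (Measure.count : Measure Λ) p = ⨆ η ∈ 𝓝ˢ (diagonal X),
              liminf (fun j => logRate (covFibre p (bowenEntourage η (D j))) (D j).encard) atTop ∧
            relEntropy (Measure.count : Measure Λ) p = ⨆ η ∈ 𝓝ˢ (diagonal X),
              limsup (fun j => logRate (covFibre p (bowenEntourage η (D j))) (D j).encard)
                atTop) := by
  have hA' : Tendsto A atTop (vanHoveFilter μ) := (isVanHoveNet_iff_tendsto μ A hA.isCompact).1 hA
  have hVH : (vanHoveFilter μ).NeBot := hA'.neBot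
  refine ⟨fun η hη => (tendsto_relEntropyAt hOW hp hη).comp hA', ?_, ?_⟩
  · intro Λ d hΛ hd N hN
    have hdens : Tendsto (fun A : Set G => ((A ∩ Λ).encard : ℝ≥0∞) / μ A) (vanHoveFilter μ)
        (𝓝 (d : ℝ≥0∞)) := tendsto_vanHoveFilter_of_nets μ hd.tendsto
    have hd0 := hΛ.density_ne_zero hdens
    obtain ⟨K, hK, hKΛ⟩ := hΛ
    obtain ⟨hN₁, hN₂⟩ := comparable_covFibre (G := G) p hN
    exact relEntropy_eq_mul_iSup hOW hp hA' hd0 (hdens.comp hA')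
      (.of_forall fun i => inter_subset_left) hK (hK.insert 1)
      (.of_forall fun i => subset_mul_inter_union_kBoundary hKΛ (A i)) hN₁ hN₂
  · intro Λ hΛ
    have := hΛ.discrete
    obtain ⟨C, W, hCW⟩ := hΛ.exists_isPrecompactFundamentalDomain
    have hdt : (μ C)⁻¹ ≠ ⊤ := ENNReal.inv_ne_top.2 hCW.measure_ne_zero
    obtain ⟨d, hd⟩ : ∃ d : ℝ≥0, (d : ℝ≥0∞) = (μ C)⁻¹ := ⟨_, ENNReal.coe_toNNReal hdt⟩
    have hd0 : d ≠ 0 := by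
      rintro rfl
      exact ENNReal.inv_ne_zero.2 (hCW.measure_ne_top (μ := μ)) (by simpa using hd.symm)
    -- Traces of Van Hove sets of `G` show that the lattice has Van Hove sets at all.
    have hneBot : (vanHoveFilter (Measure.count : Measure Λ)).NeBot :=
      (hCW.tendsto_preimage_vanHoveFilter (μ := μ)).neBot
    have hent : relEntropy μ p =
        ((d : ℝ) : EReal) * relEntropy (Measure.count : Measure Λ) p := by
      -- Along the identity on the lattice filter, the supremum of limits superior is the lattice
      -- entropy by definition.
      have h := (hCW.relEntropy_eq_mul_iSup hOW hp hd
        (tendsto_id (x := vanHoveFilter Measure.count))).2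
      simpa only [relEntropy, relEntropyAt, count_eq_encard, id] using h
    have hcancel : ∀ {a b : EReal}, ((d : ℝ) : EReal) * a = ((d : ℝ) : EReal) * b → a = b := by
      intro a b hab
      have hde : ((d : ℝ) : EReal) ≠ 0 := by exact_mod_cast hd0
      have h : ∀ x : EReal, ((d : ℝ) : EReal) * x / ((d : ℝ) : EReal) = x := fun x => by
        rw [← EReal.mul_div, EReal.mul_div_cancel (EReal.coe_ne_bot _) (EReal.coe_ne_top _) hde]
      rw [← h a, hab, h b]
    refine ⟨d, ⟨hΛ.discrete, fun J _ _ _ B hB => ?_⟩, hent, fun J _ _ _ D hD => ?_⟩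
    · have h := (hCW.tendsto_encard_preimage (μ := μ)).comp
        ((isVanHoveNet_iff_tendsto μ B hB.isCompact).1 hB)
      rw [← hd] at h
      refine h.congr fun j => ?_
      have himg : ((↑) '' ((↑) ⁻¹' B j : Set Λ) : Set G) = B j ∩ Λ := by
        rw [inter_comm]
        exact Subtype.image_preimage_coe (Λ : Set G) (B j)
      simp only [Function.comp_apply]
      rw [← himg, Subtype.val_injective.encard_image]
    · obtain ⟨h₁, h₂⟩ := hCW.relEntropy_eq_mul_iSup hOW hp hd
        ((isVanHoveNet_iff_tendsto Measure.count D hD.isCompact).1 hD)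
      -- Both sides, multiplied by the finite nonzero `d`, equal the entropy of the `G`-action.
      exact ⟨hcancel (hent.symm.trans h₁), hcancel (hent.symm.trans h₂)⟩
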